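/- **Setting.** Let $F:\mathbb R^n\times\mathbb R^m\to\mathbb R$ and $G:\mathbb R^n\to\mathbb R^p$ be twice, and $f:\mathbb R^n\times\mathbb R^m\to\mathbb R$ and $g:\mathbb R^n\times\mathbb R^m\to\mathbb R^q$ three times continuously differentiable, and let $X=\{x: G(x)\le 0\}$. Assume that for every $x\in X$: the functions $f(x,\cdot)$ and $g_i(x,\cdot)$ are convex, the set $S(x)=\operatorname{argmin}_y\{f(x,y): g(x,y)\le 0\}$ is nonempty, and there is $y$ with $g_i(x,y)<0$ for all $i$. Consider the pessimistic bilevel problem $\min_{x\in X}\max_{y\in S(x)}F(x,y)$ through its KKT reformulation: put $\mathcal L(x,y,u)=\nabla_y\big(f(x,y)+u^\top g(x,y)\big)$, $$\mathcal D(x)=\{(y,u):\mathcal L(x,y,u)=0,\ u\ge 0,\ g(x,y)\le 0,\ u^\top g(x,y)=0\},$$ $\psi_p(x)=\sup_{(y,u)\in\mathcal D(x)}F(x,y)$ and $\mathcal S_p(x)=\{(y,u)\in\mathcal D(x): F(x,y)\ge\psi_p(x)\}$. **Relaxations.** For $t>0$, $\mathcal D^t_{\mathcal R}(x)=\{(y,u):\mathcal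 L(x,y,u)=0,\ \phi^t_{i,\mathcal R}(x,y,u)\le 0,\ i=1,\dots,q\}$ with the vector-valued functions ($g_i=g_i(x,y)$) - $\mathcal R=\mathrm S$: $\phi^t_{i,\mathcal R}=(g_i,\,-u_i,\,-u_ig_i-t)$; - $\mathcal R=\mathrm{LF}$: $\phi^t_{i,\mathcal R}=(-(u_ig_i+t^2),\,-(u_i+t)(-g_i+t)+t^2)$; - $\mathcal R=\mathrm{KDB}$: $\phi^t_{i,\mathcal R}=(g_i-t,\,-u_i-t,\,-(u_i-t)(g_i+t))$; - $\mathcal R=\mathrm{SU}$: $\phi^t_{i,\mathcal R}=(g_i,\,-u_i,\,\varphi)$, where $\varphi=2u_i$ if $g_i+u_i\le -t$, $\varphi=-2g_i$ if $g_i+u_i\ge t$, and $\varphi=u_i-g_i-t\,\theta\big((u_i+g_i)/t\big)$ otherwise; - $\mathcal R=\mathrm{KS}$: $\phi^t_{i,\mathcal R}=(g_i,\,-u_i,\,\varphi)$, where $\varphi=(u_i-t)(-g_i-t)$ if $u_i-g_i\ge 2t$, and $\varphi=-\tfrac12\big((u_i-t)^2+(-g_i-t)^2\big)$ otherwise. Here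 $\theta$ is a regularization function: it is $C^2$ on $[-1,1]$, $\theta(\pm1)=1$, $\theta'(\pm1)=\pm1$, $\theta''(\pm1)=0$, and $\theta''>0$ on $(-1,1)$. Put $\psi^t_{\mathcal R}(x)=\sup_{(y,u)\in\mathcal D^t_{\mathcal R}(x)}F(x,y)$ and $\mathcal S^t_{\mathcal R}(x)=\{(y,u)\in\mathcal D^t_{\mathcal R}(x): F(x,y)\ge\psi^t_{\mathcal R}(x)\}$. A point $x$ is *stationary* for the $\mathcal R$-relaxed problem $\min_{x\in X}\psi^t_{\mathcal R}(x)$ if there are $(y,u)\in\mathcal S^t_{\mathcal R}(x)$, $\alpha\in\mathbb R^p$, $\beta\in\mathbb R^m$ and vectors $\lambda_i$ ($i=1,\dots,q$; with as many components as $\phi^t_{i,\mathcal R}$) such that, at $(x,y,u)$, $$\nabla_xF+\nabla G^\top\alpha-\nabla_x\mathcal L^\top\beta-\sum_i\nabla_x(\phi^t_{i,\mathcal R})^\top\lambda_i=0,\qquad \nabla_yF-\nabla_y\mathcal L^\top\beta-\sum_i\nabla_y(\phi^t_{i,\mathcal R})^\top\lambda_i=0,$$ $$-\nabla_yg_i\,\beta-\lambda_i^\top\,\partial\phi^t_{i,\mathcal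 R}/\partial u_i=0\quad(i=1,\dots,q),$$ and, componentwise, $\alpha\ge0$, $G\le0$, $\alpha_jG_j=0$, and $\lambda_i\ge0$, $\phi^t_{i,\mathcal R}\le0$, with every product of corresponding components of $\lambda_i$ and $\phi^t_{i,\mathcal R}$ equal to $0$. **Stationarity and qualification.** For $(y,u)\in\mathcal S_p(\bar x)$ let $\eta$, $\vartheta$, $\nu$ be the sets of indices $i$ with, respectively, $u_i=0>g_i(\bar x,y)$; $u_i=0=g_i(\bar x,y)$; $u_i>0=g_i(\bar x,y)$. Consider for $(\beta,\gamma)\in\mathbb R^m\times\mathbb R^q$ the conditions $$(*)\qquad \nabla_yg_i(\bar x,y)\beta=0\ (i\in\nu),\qquad \gamma_i=0\ (i\in\eta),$$ $$(\mathrm C)\quad \gamma_i\,\nabla_yg_i(\bar x,y)\beta\ge0\ \ (i\in\vartheta),\qquad (\mathrm M)\quad (\gamma_i<0\ \text{and}\ \nabla_yg_i(\bar x,y)\beta<0)\ \text{ or }\ \gamma_i\,\nabla_yg_i(\bar x,y)\beta=0\ \ (i\in\vartheta).$$ The point $\bar x$ is *C-stationary* (*M-stationary*) if there are $(y,u)\in\mathcal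 S_p(\bar x)$ and $(\alpha,\beta,\gamma)$ with $\alpha\ge0$, $G(\bar x)\le0$, $\alpha^\top G(\bar x)=0$, $(*)$, and (C) (respectively (M)), such that, at $(\bar x,y,u)$, $\nabla_xF+\nabla G^\top\alpha+\nabla_x\mathcal L^\top\beta+\nabla_xg^\top\gamma=0$ and $\nabla_yF+\nabla_y\mathcal L^\top\beta+\nabla_yg^\top\gamma=0$. The condition $(A_1^c)$ (respectively $(A_1^m)$) holds at $(\bar x,y,u)$ if $(\beta,\gamma)=0$ is the only solution of $(*)$, (C) (respectively (M)), $\nabla_x\mathcal L^\top\beta+\nabla_xg^\top\gamma=0$ and $\nabla_y\mathcal L^\top\beta+\nabla_yg^\top\gamma=0$; the condition $(A_2^c)$ (respectively $(A_2^m)$) holds if every solution of $(*)$, (C) (respectively (M)) and $\nabla_y\mathcal L^\top\beta+\nabla_yg^\top\gamma=0$ satisfies $\nabla_x\mathcal L^\top\beta+\nabla_xg^\top\gamma=0$. The point $\bar x$ is *upper-level regular* if $\nabla G(\bar x)^\top\alpha=0$, $\alpha\ge0$, $\alpha^\top G(\bar x)=0$ imply $\alpha=0$. The excess of $A$ over $B$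 is $e(A,B)=\sup_{z\in A}d(z,B)$. **Theorem.** Let $\mathcal R\in\{\mathrm S,\mathrm{LF},\mathrm{KDB},\mathrm{SU},\mathrm{KS}\}$, let $t_k>0$ with $t_k\to0$, let $x^k$ be a stationary point of the $\mathcal R$-relaxed problem for $t=t_k$, and let $x^k\to\bar x$. Suppose that $e\big(\mathcal S^{t_k}_{\mathcal R}(x^k),\mathcal S_p(\bar x)\big)\to0$, that $\bar x$ is upper-level regular, and that $\mathcal S_p(\bar x)$ is nonempty and compact. 1. If $\mathcal R\in\{\mathrm S,\mathrm{LF},\mathrm{SU}\}$ and $(A_1^m)$ and $(A_2^m)$ hold at $(\bar x,y,u)$ for all $(y,u)\in\mathcal S_p(\bar x)$, then $\bar x$ is C-stationary. 2. If $\mathcal R\in\{\mathrm{KDB},\mathrm{KS}\}$ and $(A_1^c)$ and $(A_2^c)$ hold at $(\bar x,y,u)$ for all $(y,u)\in\mathcal S_p(\bar x)$, then $\bar x$ is M-stationary. -/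

import Mathlib

open Set Filter Topology

/-- Euclidean space of dimension `n`. -/
abbrev Vec (n : ℕ) : Type := EuclideanSpace ℝ (Fin n)

/-- The excess `e(A, B) = sup_{z ∈ A} d(z, B)` of `A` over `B`, for subsets of `ℝ^m × ℝ^q = ℝ^{m+q}`
with the Euclidean distance of `ℝ^{m+q}`. As an extended nonnegative number it satisfies
`e(∅, B) = 0`, and `e(A, ∅) = ∞` for nonempty `A`. -/
noncomputable def excess {m q : ℕ} (A B : Set (Vec m × Vec q)) : ENNReal :=
  ⨆ z ∈ A, ⨅ w ∈ B, ENNReal.ofReal (Real.sqrt (‖z.1 - w.1‖ ^ 2 + ‖z.2 - w.2‖ ^ 2))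

/-- The data of a pessimistic bilevel program `min_{x ∈ X} max_{y ∈ S(x)} F(x, y)`, where
`X = {x | G(x) ≤ 0}` and `S(x) = argmin_y {f(x, y) | g(x, y) ≤ 0}`. -/
structure BilevelData (n m p q : ℕ) where
  /-- upper-level objective -/
  F : Vec n → Vec m → ℝ
  /-- upper-level constraints -/
  G : Fin p → Vec n → ℝ
  /-- lower-level objective -/
  f : Vec n → Vec m → ℝ
  /-- lower-level constraints -/
  g : Fin q → Vec n → Vec m → ℝ

/-- The five relaxation schemes: Scholtes, Lin--Fukushima, Kadrani--Dussault--Benchakroun,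
Steffensen--Ulbrich, Kanzow--Schwartz. -/
inductive Scheme
  | S
  | LF
  | KDB
  | SU
  | KS

/-- Number of scalar inequalities by which a scheme replaces one complementarity condition. -/
def Scheme.numIneq : Scheme → ℕ
  | .LF => 2
  | .S => 3
  | .KDB => 3
  | .SU => 3
  | .KS => 3

/-- Regularization functions on `[-1, 1]`: twice continuously differentiable there, with
`θ(±1) = 1`, `θ'(±1) = ±1`, `θ''(±1) = 0`, and `θ'' > 0` on `(-1, 1)`. -/
structure IsRegularization (θ : ℝ → ℝ) : Prop where
  contDiffOn : ContDiffOn ℝ 2 θ (Icc (-1) 1)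
  left : θ (-1) = 1
  right : θ 1 = 1
  deriv_left : derivWithin θ (Icc (-1) 1) (-1) = -1
  deriv_right : derivWithin θ (Icc (-1) 1) 1 = 1
  deriv2_left : derivWithin (derivWithin θ (Icc (-1) 1)) (Icc (-1) 1) (-1) = 0
  deriv2_right : derivWithin (derivWithin θ (Icc (-1) 1)) (Icc (-1) 1) 1 = 0
  deriv2_pos : ∀ z ∈ Ioo (-1 : ℝ) 1,
    0 < derivWithin (derivWithin θ (Icc (-1) 1)) (Icc (-1) 1) z

/-- The Steffensen--Ulbrich function, with `a` for `u_i` and `b` for `g_i(x, y)`. -/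
noncomputable def relaxSU (θ : ℝ → ℝ) (t a b : ℝ) : ℝ :=
  if b + a ≤ -t then 2 * a
  else if t ≤ b + a then -2 * b
  else a - b - t * θ ((a + b) / t)

/-- The Kanzow--Schwartz function, with `a` for `u_i` and `b` for `g_i(x, y)`. -/
noncomputable def relaxKS (t a b : ℝ) : ℝ :=
  if 2 * t ≤ a - b then (a - t) * (-b - t)
  else -(1 / 2) * ((a - t) ^ 2 + (-b - t) ^ 2)

/-- The vector of functions required to be `≤ 0` in place of the complementarity condition
`u_i ≥ 0`, `g_i ≤ 0`, `u_i g_i = 0`, with `a` for `u_i` and `b` for `g_i(x, y)`. -/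
noncomputable def relaxVec (θ : ℝ → ℝ) : (R : Scheme) → (t a b : ℝ) → Fin R.numIneq → ℝ
  | .S, t, a, b => ![b, -a, -(a * b) - t]
  | .LF, t, a, b => ![-(a * b + t ^ 2), -((a + t) * (-b + t)) + t ^ 2]
  | .KDB, t, a, b => ![b - t, -a - t, -((a - t) * (b + t))]
  | .SU, t, a, b => ![b, -a, relaxSU θ t a b]
  | .KS, t, a, b => ![b, -a, relaxKS t a b]

/-- Sign condition of C-type on a pair of multipliers. -/
def CSign (a b : ℝ) : Prop := 0 ≤ a * b

/-- Sign condition of M-type on a pair of multipliers. -/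
def MSign (a b : ℝ) : Prop := (a < 0 ∧ b < 0) ∨ a * b = 0

namespace BilevelData

/-- The upper-level feasible set. -/
def X {n m p q : ℕ} (P : BilevelData n m p q) : Set (Vec n) := {x | ∀ j, P.G j x ≤ 0}

/-- The lower-level feasible set. -/
def Y {n m p q : ℕ} (P : BilevelData n m p q) (x : Vec n) : Set (Vec m) :=
  {y | ∀ i, P.g i x y ≤ 0}

/-- The lower-level optimal solution set. -/
def lowerSol {n m p q : ℕ} (P : BilevelData n m p q) (x : Vec n) : Set (Vec m) :=
  {y | y ∈ P.Y x ∧ ∀ y' ∈ P.Y x, P.f x y ≤ P.f x y'}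

/-- The assumptions on the data: solvable and convex lower-level problems satisfying the Slater
condition for all upper-level feasible `x`, and smoothness of all functions. -/
structure Standing {n m p q : ℕ} (P : BilevelData n m p q) : Prop where
  solvable : ∀ x ∈ P.X, (P.lowerSol x).Nonempty
  convex_f : ∀ x ∈ P.X, ConvexOn ℝ univ (P.f x)
  convex_g : ∀ x ∈ P.X, ∀ i, ConvexOn ℝ univ (P.g i x)
  slater : ∀ x ∈ P.X, ∃ y, ∀ i, P.g i x y < 0
  smooth_F : ContDiff ℝ 2 (fun z : Vec n × Vec m => P.F z.1 z.2)
  smooth_G : ∀ j, ContDiff ℝ 2 (P.G j)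
  smooth_f : ContDiff ℝ 3 (fun z : Vec n × Vec m => P.f z.1 z.2)
  smooth_g : ∀ i, ContDiff ℝ 3 (fun z : Vec n × Vec m => P.g i z.1 z.2)

/-- The lower-level Lagrangian `L(x, y, u) = f(x, y) + uᵀ g(x, y)`. -/
noncomputable def lagr {n m p q : ℕ} (P : BilevelData n m p q)
    (x : Vec n) (y : Vec m) (u : Vec q) : ℝ :=
  P.f x y + ∑ i, u i * P.g i x y

/-- The function `𝓛(x, y, u) = ∇_y L(x, y, u)`. -/
noncomputable def gradLagr {n m p q : ℕ} (P : BilevelData n m p q)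
    (x : Vec n) (y : Vec m) (u : Vec q) : Vec m :=
  gradient (fun y' => P.lagr x y' u) y

/-- The pairs `(y, u)` satisfying the lower-level Karush--Kuhn--Tucker conditions at `x`. -/
def D {n m p q : ℕ} (P : BilevelData n m p q) (x : Vec n) : Set (Vec m × Vec q) :=
  {z | P.gradLagr x z.1 z.2 = 0 ∧ (∀ i, 0 ≤ z.2 i) ∧ (∀ i, P.g i x z.1 ≤ 0) ∧
    ∑ i, z.2 i * P.g i x z.1 = 0}

/-- The optimal value `ψ_p(x) = sup {F(x, y) | (y, u) ∈ D(x)}`, as an extended real number. -/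
noncomputable def psi {n m p q : ℕ} (P : BilevelData n m p q) (x : Vec n) : EReal :=
  ⨆ z ∈ P.D x, (P.F x z.1 : EReal)

/-- The solution set `S_p(x) = {(y, u) ∈ D(x) | F(x, y) ≥ ψ_p(x)}`. -/
def Sp {n m p q : ℕ} (P : BilevelData n m p q) (x : Vec n) : Set (Vec m × Vec q) :=
  {z | z ∈ P.D x ∧ P.psi x ≤ (P.F x z.1 : EReal)}

/-- The component `c` of the relaxation function `φ^t_{i,R}(x, y, u)`. -/
noncomputable def phi {n m p q : ℕ} (P : BilevelData n m p q) (θ : ℝ → ℝ) (R : Scheme) (t : ℝ)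
    (i : Fin q) (c : Fin R.numIneq) (x : Vec n) (y : Vec m) (u : Vec q) : ℝ :=
  relaxVec θ R t (u i) (P.g i x y) c

/-- The relaxed feasible set `D^t_R(x)`. -/
def DR {n m p q : ℕ} (P : BilevelData n m p q) (θ : ℝ → ℝ) (R : Scheme) (t : ℝ) (x : Vec n) :
    Set (Vec m × Vec q) :=
  {z | P.gradLagr x z.1 z.2 = 0 ∧ ∀ i c, P.phi θ R t i c x z.1 z.2 ≤ 0}

/-- The relaxed optimal value `ψ^t_R(x)`, as an extended real number. -/
noncomputable def psiR {n m p q : ℕ} (P : BilevelData n m p q) (θ : ℝ → ℝ) (R : Scheme) (t : ℝ)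
    (x : Vec n) : EReal :=
  ⨆ z ∈ P.DR θ R t x, (P.F x z.1 : EReal)

/-- The relaxed solution set `S^t_R(x)`. -/
def SR {n m p q : ℕ} (P : BilevelData n m p q) (θ : ℝ → ℝ) (R : Scheme) (t : ℝ) (x : Vec n) :
    Set (Vec m × Vec q) :=
  {z | z ∈ P.DR θ R t x ∧ P.psiR θ R t x ≤ (P.F x z.1 : EReal)}

/-- `∇_x g_i(x, y)`. -/
noncomputable def gradxg {n m p q : ℕ} (P : BilevelData n m p q) (i : Fin q)
    (x : Vec n) (y : Vec m) : Vec n :=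
  gradient (fun x' => P.g i x' y) x

/-- `∇_y g_i(x, y)`. -/
noncomputable def gradyg {n m p q : ℕ} (P : BilevelData n m p q) (i : Fin q)
    (x : Vec n) (y : Vec m) : Vec m :=
  gradient (fun y' => P.g i x y') y

/-- `∇_x 𝓛(x, y, u)ᵀ β = ∑_l β_l ∇_x 𝓛_l(x, y, u)`. -/
noncomputable def gradxLagrT {n m p q : ℕ} (P : BilevelData n m p q)
    (x : Vec n) (y : Vec m) (u : Vec q) (β : Vec m) : Vec n :=
  ∑ l, β l • gradient (fun x' => P.gradLagr x' y u l) x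

/-- `∇_y 𝓛(x, y, u)ᵀ β = ∑_l β_l ∇_y 𝓛_l(x, y, u)`. -/
noncomputable def gradyLagrT {n m p q : ℕ} (P : BilevelData n m p q)
    (x : Vec n) (y : Vec m) (u : Vec q) (β : Vec m) : Vec m :=
  ∑ l, β l • gradient (fun y' => P.gradLagr x y' u l) y

/-- Stationary points of the `R`-relaxed problem `min_{x ∈ X} ψ^t_R(x)`: there are `(y, u)` in
`S^t_R(x)` and multipliers such that the derivatives in `x`, `y`, `u` of
`F + αᵀ G - βᵀ 𝓛 - ∑_i λ_iᵀ φ^t_{i,R}` vanish, with the usual sign and complementarity conditions.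
The derivative in `u_i` is `-∇_y g_i β - λ_iᵀ ∂φ^t_{i,R}/∂u_i`. -/
def IsRelaxedStationary {n m p q : ℕ} (P : BilevelData n m p q) (θ : ℝ → ℝ) (R : Scheme) (t : ℝ)
    (x : Vec n) : Prop :=
  ∃ (y : Vec m) (u : Vec q) (α : Fin p → ℝ) (β : Vec m) (lam : Fin q → Fin R.numIneq → ℝ),
    (y, u) ∈ P.SR θ R t x ∧
    gradient (fun x' => P.F x' y) x + ∑ j, α j • gradient (P.G j) x - P.gradxLagrT x y u β
      - ∑ i, ∑ c, lam i c • gradient (fun x' => P.phi θ R t i c x' y u) x = 0 ∧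
    gradient (fun y' => P.F x y') y - P.gradyLagrT x y u β
      - ∑ i, ∑ c, lam i c • gradient (fun y' => P.phi θ R t i c x y' u) y = 0 ∧
    (∀ i, -(inner ℝ (P.gradyg i x y) β)
      - ∑ c, lam i c * gradient (fun u' => P.phi θ R t i c x y u') u i = 0) ∧
    (∀ j, 0 ≤ α j ∧ P.G j x ≤ 0 ∧ α j * P.G j x = 0) ∧
    (∀ i c, 0 ≤ lam i c ∧ P.phi θ R t i c x y u ≤ 0 ∧ lam i c * P.phi θ R t i c x y u = 0)

/-- The index set `η` (inactive lower-level constraint, zero multiplier). -/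
def eta {n m p q : ℕ} (P : BilevelData n m p q) (x : Vec n) (y : Vec m) (u : Vec q) :
    Set (Fin q) := {i | u i = 0 ∧ P.g i x y < 0}

/-- The biactive index set. -/
def biactive {n m p q : ℕ} (P : BilevelData n m p q) (x : Vec n) (y : Vec m) (u : Vec q) :
    Set (Fin q) := {i | u i = 0 ∧ P.g i x y = 0}

/-- The index set `ν` (active lower-level constraint, positive multiplier). -/
def nu {n m p q : ℕ} (P : BilevelData n m p q) (x : Vec n) (y : Vec m) (u : Vec q) :
    Set (Fin q) := {i | 0 < u i ∧ P.g i x y = 0}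

/-- The conditions `∇_y g_ν β = 0`, `γ_η = 0`, together with the sign condition `sgn` on the pairs
`(γ_i, ∇_y g_i β)` for the biactive indices `i`. -/
def SignConds {n m p q : ℕ} (P : BilevelData n m p q) (sgn : ℝ → ℝ → Prop)
    (x : Vec n) (y : Vec m) (u : Vec q) (β : Vec m) (γ : Fin q → ℝ) : Prop :=
  (∀ i ∈ P.nu x y u, inner ℝ (P.gradyg i x y) β = 0) ∧
  (∀ i ∈ P.eta x y u, γ i = 0) ∧
  (∀ i ∈ P.biactive x y u, sgn (γ i) (inner ℝ (P.gradyg i x y) β))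

/-- Stationarity for the pessimistic bilevel program, relative to the sign condition `sgn` on the
multipliers belonging to biactive indices. -/
def IsStationaryWith {n m p q : ℕ} (P : BilevelData n m p q) (sgn : ℝ → ℝ → Prop)
    (x : Vec n) : Prop :=
  ∃ (y : Vec m) (u : Vec q) (α : Fin p → ℝ) (β : Vec m) (γ : Fin q → ℝ),
    (y, u) ∈ P.Sp x ∧
    gradient (fun x' => P.F x' y) x + ∑ j, α j • gradient (P.G j) x + P.gradxLagrT x y u β
      + ∑ i, γ i • P.gradxg i x y = 0 ∧
    gradient (fun y' => P.F x y') y + P.gradyLagrT x y u β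
      + ∑ i, γ i • P.gradyg i x y = 0 ∧
    (∀ j, 0 ≤ α j) ∧ (∀ j, P.G j x ≤ 0) ∧ ∑ j, α j * P.G j x = 0 ∧
    P.SignConds sgn x y u β γ

/-- C-stationary points. -/
def IsCStationary {n m p q : ℕ} (P : BilevelData n m p q) (x : Vec n) : Prop :=
  P.IsStationaryWith CSign x

/-- M-stationary points. -/
def IsMStationary {n m p q : ℕ} (P : BilevelData n m p q) (x : Vec n) : Prop :=
  P.IsStationaryWith MSign x

/-- Upper-level regularity at `x`. -/
def UpperRegular {n m p q : ℕ} (P : BilevelData n m p q) (x : Vec n) : Prop :=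
  ∀ α : Fin p → ℝ, ∑ j, α j • gradient (P.G j) x = 0 → (∀ j, 0 ≤ α j) →
    ∑ j, α j * P.G j x = 0 → α = 0

/-- The multiplier set `Λ_y(x, y, u, 0)`, in which only derivatives in `y` occur. -/
def multY {n m p q : ℕ} (P : BilevelData n m p q) (sgn : ℝ → ℝ → Prop)
    (x : Vec n) (y : Vec m) (u : Vec q) : Set (Vec m × (Fin q → ℝ)) :=
  {w | P.SignConds sgn x y u w.1 w.2 ∧
    P.gradyLagrT x y u w.1 + ∑ i, w.2 i • P.gradyg i x y = 0}

/-- The multiplier set `Λ(x, y, u, 0)`, in which derivatives in `x` and in `y` occur. -/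
def mult {n m p q : ℕ} (P : BilevelData n m p q) (sgn : ℝ → ℝ → Prop)
    (x : Vec n) (y : Vec m) (u : Vec q) : Set (Vec m × (Fin q → ℝ)) :=
  {w | P.SignConds sgn x y u w.1 w.2 ∧
    P.gradxLagrT x y u w.1 + ∑ i, w.2 i • P.gradxg i x y = 0 ∧
    P.gradyLagrT x y u w.1 + ∑ i, w.2 i • P.gradyg i x y = 0}

/-- First qualification condition at `(x, y, u)`: `Λ(x, y, u, 0)` contains only zero. -/
def QualOne {n m p q : ℕ} (P : BilevelData n m p q) (sgn : ℝ → ℝ → Prop)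
    (x : Vec n) (y : Vec m) (u : Vec q) : Prop :=
  ∀ β γ, (β, γ) ∈ P.mult sgn x y u → β = 0 ∧ γ = 0

/-- Second qualification condition at `(x, y, u)`: all elements of `Λ_y(x, y, u, 0)` satisfy
`∇_x 𝓛ᵀ β + ∇_x gᵀ γ = 0`. -/
def QualTwo {n m p q : ℕ} (P : BilevelData n m p q) (sgn : ℝ → ℝ → Prop)
    (x : Vec n) (y : Vec m) (u : Vec q) : Prop :=
  ∀ β γ, (β, γ) ∈ P.multY sgn x y u →
    P.gradxLagrT x y u β + ∑ i, γ i • P.gradxg i x y = 0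

end BilevelData

/-! At a relaxed stationary point the multipliers `λ_i` enter the gradient equations only through
the two numbers `γ_i = -∑ λ_c ∂φ_c/∂b` and `ι_i = ∑ λ_c ∂φ_c/∂a`, where `a = u_i` and `b = g_i`. The
`u`-equation identifies `ι_i` with `∇_y g_i β`, once the sign of `β` is reversed, so the relaxed
system already has the shape of the limiting one.

A scheme is then relevant only through the pairs it permits (`RelaxPair`). For all five schemes `γ_i
ι_i ≥ 0`, and two estimates (`PairBounds`) force `ι_i → 0` where the limit has `u_i > 0 = g_i`, and
`γ_i → 0` where it has `u_i = 0 > g_i`. For KDB and KS the two numbers are moreover never both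
positive. These facts are invariant under nonnegative scaling and survive limits.

Excess and compactness give a cluster point `(y, u)` of the relaxed solutions in `S_p(xbar)`.
Normalizing `(1, α, β, γ)` to the unit sphere yields, along a subsequence, a nonzero limit `(s, α,
β, γ)` satisfying a Fritz John system (`exists_fritzJohn_limit`).

It remains to exclude `s = 0`. The `y`-equation paired with `β` then reads: a positive semidefinite
quadratic form plus the sum of the products `γ_i ∇_y g_i β` is zero. Lower-level convexity thus
makes every product vanish, so C-type multipliers are M-type (`Standing.multY_cSign_subset`), and
either version of the qualification conditions applies. The second condition removes the lower-level
terms from the `x`-equation, upper-level regularity gives `α = 0`, and the first condition gives `β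
= γ = 0`, a contradiction. Division by `s` finishes the proof. -/

/-- Two one-sided derivatives that agree make a derivative of the glued function. -/
lemma hasDerivAt_of_Iic_Ici {f l r : ℝ → ℝ} {a d : ℝ}
    (hl : HasDerivWithinAt l d (Iic a) a) (hr : HasDerivWithinAt r d (Ici a) a)
    (h1 : ∀ᶠ z in 𝓝[Iic a] a, f z = l z) (h2 : ∀ᶠ z in 𝓝[Ici a] a, f z = r z) :
    HasDerivAt f d a := by
  have h := (hl.congr_of_eventuallyEq h1 (h1.self_of_nhdsWithin self_mem_Iic)).union
    (hr.congr_of_eventuallyEq h2 (h2.self_of_nhdsWithin self_mem_Ici))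
  rwa [Iic_union_Ici, hasDerivWithinAt_univ] at h

/-- This squared positive part is the correction term joining the two branches of the
Kanzow–Schwartz function. -/
lemma hasDerivAt_max_zero_sq (x : ℝ) :
    HasDerivAt (fun z : ℝ => max z 0 ^ 2) (2 * max x 0) x := by
  rcases lt_trichotomy x 0 with h | rfl | h
  · rw [max_eq_right h.le, mul_zero]
    refine (hasDerivAt_const x (0 : ℝ)).congr_of_eventuallyEq ?_
    filter_upwards [Iio_mem_nhds h] with z hz
    simp [max_eq_right (le_of_lt (mem_Iio.1 hz))]
  · refine hasDerivAt_of_Iic_Ici (l := fun _ => 0) (r := fun z => z ^ 2) ?_ ?_ ?_ ?_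
    · simpa using hasDerivWithinAt_const (0 : ℝ) (Iic 0) (0 : ℝ)
    · simpa using (hasDerivAt_pow 2 (0 : ℝ)).hasDerivWithinAt
    · filter_upwards [self_mem_nhdsWithin] with z hz
      simp [max_eq_right (mem_Iic.1 hz)]
    · filter_upwards [self_mem_nhdsWithin] with z hz
      simp [max_eq_left (mem_Ici.1 hz)]
  · rw [max_eq_left h.le]
    refine HasDerivAt.congr_of_eventuallyEq (f := fun z => z ^ 2)
      (by simpa using hasDerivAt_pow 2 x) ?_
    filter_upwards [Ioi_mem_nhds h] with z hz
    simp [max_eq_left (le_of_lt (mem_Ioi.1 hz))]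

/-! ### Regularization functions lie strictly above the absolute value. -/

namespace IsRegularization

variable {θ : ℝ → ℝ}

lemma hasDerivWithinAt (hθ : IsRegularization θ) {z : ℝ} (hz : z ∈ Icc (-1 : ℝ) 1) :
    HasDerivWithinAt θ (derivWithin θ (Icc (-1) 1) z) (Icc (-1) 1) z :=
  (hθ.contDiffOn.differentiableOn (by norm_num) z hz).hasDerivWithinAt

lemma strictMonoOn_derivWithin (hθ : IsRegularization θ) :
    StrictMonoOn (derivWithin θ (Icc (-1) 1)) (Icc (-1) 1) := by
  have hc : ContDiffOn ℝ 1 (derivWithin θ (Icc (-1) 1)) (Icc (-1) 1) :=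
    hθ.contDiffOn.derivWithin (uniqueDiffOn_Icc (by norm_num)) (by norm_num)
  refine strictMonoOn_of_deriv_pos (convex_Icc _ _) hc.continuousOn fun z hz => ?_
  rw [interior_Icc] at hz
  rw [← derivWithin_of_mem_nhds (Icc_mem_nhds hz.1 hz.2)]
  exact hθ.deriv2_pos z hz

lemma neg_one_lt_derivWithin (hθ : IsRegularization θ) {z : ℝ} (hz : z ∈ Ioo (-1 : ℝ) 1) :
    -1 < derivWithin θ (Icc (-1) 1) z := by
  refine hθ.deriv_left.symm.trans_lt ?_
  exact hθ.strictMonoOn_derivWithin (by norm_num) (Ioo_subset_Icc_self hz) hz.1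

lemma derivWithin_lt_one (hθ : IsRegularization θ) {z : ℝ} (hz : z ∈ Ioo (-1 : ℝ) 1) :
    derivWithin θ (Icc (-1) 1) z < 1 := by
  refine lt_of_lt_of_eq ?_ hθ.deriv_right
  exact hθ.strictMonoOn_derivWithin (Ioo_subset_Icc_self hz) (by norm_num) hz.2

/-- Since `θ' < 1` inside the interval, `θ z - z` decreases strictly to its value `0` at `1`.
Together with its mirror image this gives `|z| < θ z`, which keeps `u_i` and `g_i` away from zero
when the smoothed constraint is active. -/
lemma lt_apply (hθ : IsRegularization θ) {z : ℝ} (hz : z ∈ Ioo (-1 : ℝ) 1) : z < θ z := by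
  have h : StrictAntiOn (fun z => θ z - z) (Icc (-1) 1) := by
    refine strictAntiOn_of_deriv_neg (convex_Icc _ _)
      (hθ.contDiffOn.continuousOn.sub continuousOn_id) fun w hw => ?_
    rw [interior_Icc] at hw
    have := ((hθ.hasDerivWithinAt (Ioo_subset_Icc_self hw)).hasDerivAt
      (Icc_mem_nhds hw.1 hw.2)).sub (hasDerivAt_id w)
    refine this.deriv.trans_lt ?_
    linarith [hθ.derivWithin_lt_one hw]
  have := h (Ioo_subset_Icc_self hz) (by norm_num : (1 : ℝ) ∈ Icc (-1 : ℝ) 1) hz.2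
  simp only [hθ.right] at this
  linarith

lemma neg_lt_apply (hθ : IsRegularization θ) {z : ℝ} (hz : z ∈ Ioo (-1 : ℝ) 1) : -z < θ z := by
  have h : StrictMonoOn (fun z => θ z + z) (Icc (-1) 1) := by
    refine strictMonoOn_of_deriv_pos (convex_Icc _ _)
      (hθ.contDiffOn.continuousOn.add continuousOn_id) fun w hw => ?_
    rw [interior_Icc] at hw
    have := ((hθ.hasDerivWithinAt (Ioo_subset_Icc_self hw)).hasDerivAt
      (Icc_mem_nhds hw.1 hw.2)).add (hasDerivAt_id w)
    refine lt_of_lt_of_eq ?_ this.deriv.symm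
    linarith [hθ.neg_one_lt_derivWithin hw]
  have := h (by norm_num : (-1 : ℝ) ∈ Icc (-1 : ℝ) 1) (Ioo_subset_Icc_self hz) hz.1
  simp only [hθ.left] at this
  linarith

end IsRegularization

/-! ### Differentiability and partial derivatives of the relaxation functions. -/

/-- The extension of a regularization function from `[-1, 1]` to the line by `|z|`. -/
noncomputable def extendReg (θ : ℝ → ℝ) (z : ℝ) : ℝ :=
  if z ≤ -1 then -z else if 1 ≤ z then z else θ z

/-- The derivative of `extendReg θ`. -/
noncomputable def extendRegDeriv (θ : ℝ → ℝ) (z : ℝ) : ℝ :=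
  if z ≤ -1 then -1 else if 1 ≤ z then 1 else derivWithin θ (Icc (-1) 1) z

/-- The values and slopes prescribed for `θ` at `±1` are those of the absolute value, so the pieces
glue differentiably. -/
lemma hasDerivAt_extendReg {θ : ℝ → ℝ} (hθ : IsRegularization θ) (z : ℝ) :
    HasDerivAt (extendReg θ) (extendRegDeriv θ z) z := by
  rcases lt_trichotomy z (-1) with h | rfl | h
  · rw [extendRegDeriv, if_pos h.le]
    refine (hasDerivAt_neg z).congr_of_eventuallyEq ?_
    filter_upwards [Iio_mem_nhds h] with w hw
    rw [extendReg, if_pos (le_of_lt hw)]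
  · rw [extendRegDeriv, if_pos le_rfl]
    have hd := hθ.hasDerivWithinAt (by norm_num : (-1 : ℝ) ∈ Icc (-1 : ℝ) 1)
    rw [hθ.deriv_left] at hd
    have hI : Icc (-1 : ℝ) 1 ∈ 𝓝[Ici (-1)] (-1) := Icc_mem_nhdsGE (by norm_num)
    refine hasDerivAt_of_Iic_Ici (hasDerivAt_neg _).hasDerivWithinAt
      (hd.mono_of_mem_nhdsWithin hI) ?_ ?_
    · filter_upwards [self_mem_nhdsWithin] with w hw
      rw [extendReg, if_pos (mem_Iic.1 hw)]
    · filter_upwards [Ico_mem_nhdsGE (by norm_num : (-1 : ℝ) < 1)] with w hw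
      rcases hw.1.eq_or_lt with rfl | h'
      · rw [extendReg, if_pos le_rfl, hθ.left, neg_neg]
      · rw [extendReg, if_neg h'.not_ge, if_neg hw.2.not_ge]
  rw [extendRegDeriv, if_neg h.not_ge]
  rcases lt_trichotomy z 1 with h1 | rfl | h1
  · rw [if_neg h1.not_ge]
    refine ((hθ.hasDerivWithinAt ⟨h.le, h1.le⟩).hasDerivAt
      (Icc_mem_nhds h h1)).congr_of_eventuallyEq ?_
    filter_upwards [Ioo_mem_nhds h h1] with w hw
    rw [extendReg, if_neg hw.1.not_ge, if_neg hw.2.not_ge]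
  · rw [if_pos le_rfl]
    have hd := hθ.hasDerivWithinAt (by norm_num : (1 : ℝ) ∈ Icc (-1 : ℝ) 1)
    rw [hθ.deriv_right] at hd
    have hI : Icc (-1 : ℝ) 1 ∈ 𝓝[Iic 1] 1 := Icc_mem_nhdsLE (by norm_num)
    refine hasDerivAt_of_Iic_Ici (hd.mono_of_mem_nhdsWithin hI)
      (hasDerivAt_id _).hasDerivWithinAt ?_ ?_
    · filter_upwards [Ioc_mem_nhdsLE (by norm_num : (-1 : ℝ) < 1)] with w hw
      rw [extendReg, if_neg hw.1.not_ge]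
      rcases hw.2.eq_or_lt with rfl | h'
      · rw [if_pos le_rfl, hθ.right]
      · rw [if_neg h'.not_ge]
    · filter_upwards [self_mem_nhdsWithin] with w hw
      have hw : (1 : ℝ) ≤ w := hw
      rw [extendReg, if_neg (by linarith), if_pos hw, id]
  · rw [if_pos h1.le]
    refine (hasDerivAt_id z).congr_of_eventuallyEq ?_
    filter_upwards [Ioi_mem_nhds h1] with w hw
    have hw : (1 : ℝ) < w := hw
    rw [extendReg, if_neg (by linarith), if_pos hw.le, id]

lemma neg_one_le_extendRegDeriv {θ : ℝ → ℝ} (hθ : IsRegularization θ) (z : ℝ) :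
    -1 ≤ extendRegDeriv θ z := by
  unfold extendRegDeriv
  split_ifs with h1 h2
  · exact le_rfl
  · norm_num
  · exact (hθ.neg_one_lt_derivWithin ⟨not_le.1 h1, not_le.1 h2⟩).le

lemma extendRegDeriv_le_one {θ : ℝ → ℝ} (hθ : IsRegularization θ) (z : ℝ) :
    extendRegDeriv θ z ≤ 1 := by
  unfold extendRegDeriv
  split_ifs with h1 h2
  · norm_num
  · exact le_rfl
  · exact (hθ.derivWithin_lt_one ⟨not_le.1 h1, not_le.1 h2⟩).le

/-- The three branches become one formula, the function `a - b - |a + b|` with its modulus smoothed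
at scale `t`. -/
lemma relaxSU_eq {θ : ℝ → ℝ} {t : ℝ} (ht : 0 < t) (a b : ℝ) :
    relaxSU θ t a b = a - b - t * extendReg θ ((a + b) / t) := by
  have e1 : (a + b) / t ≤ -1 ↔ b + a ≤ -t := by
    rw [div_le_iff₀ ht, neg_one_mul, add_comm]
  have e2 : 1 ≤ (a + b) / t ↔ t ≤ b + a := by
    rw [le_div_iff₀ ht, one_mul, add_comm]
  unfold relaxSU extendReg
  simp only [e1, e2]
  split_ifs
  · field_simp; ring
  · field_simp; ring
  · rfl

/-- The two branches differ by `(a - b - 2 * t) ^ 2 / 2`, which vanishes to second order on the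
switching line. -/
lemma relaxKS_eq (t a b : ℝ) :
    relaxKS t a b =
      -(1 / 2) * ((a - t) ^ 2 + (-b - t) ^ 2) + 1 / 2 * max (a - b - 2 * t) 0 ^ 2 := by
  unfold relaxKS
  split_ifs with h
  · rw [max_eq_left (by linarith)]; ring
  · rw [max_eq_right (by linarith)]; ring

/-- The derivative of `relaxVec` in `a`. -/
noncomputable def relaxVecDa (θ : ℝ → ℝ) : (R : Scheme) → (t a b : ℝ) → Fin R.numIneq → ℝ
  | .S, _, _, b => ![0, -1, -b]
  | .LF, t, _, b => ![-b, -(-b + t)]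
  | .KDB, t, _, b => ![0, -1, -(b + t)]
  | .SU, t, a, b => ![0, -1, 1 - extendRegDeriv θ ((a + b) / t)]
  | .KS, t, a, b => ![0, -1, -(a - t) + max (a - b - 2 * t) 0]

/-- The derivative of `relaxVec` in `b`. -/
noncomputable def relaxVecDb (θ : ℝ → ℝ) : (R : Scheme) → (t a b : ℝ) → Fin R.numIneq → ℝ
  | .S, _, a, _ => ![1, 0, -a]
  | .LF, t, a, _ => ![-a, a + t]
  | .KDB, t, a, _ => ![1, 0, -(a - t)]
  | .SU, t, a, b => ![1, 0, -1 - extendRegDeriv θ ((a + b) / t)]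
  | .KS, t, a, b => ![1, 0, (-b - t) - max (a - b - 2 * t) 0]

lemma hasDerivAt_relaxVec_a {θ : ℝ → ℝ} (hθ : IsRegularization θ) (R : Scheme) {t : ℝ}
    (ht : 0 < t) (a b : ℝ) (c : Fin R.numIneq) :
    HasDerivAt (fun a' => relaxVec θ R t a' b c) (relaxVecDa θ R t a b c) a := by
  have hid := hasDerivAt_id a
  have hb : HasDerivAt (fun _ : ℝ => b) 0 a := hasDerivAt_const a b
  have hneg : HasDerivAt (fun a' : ℝ => -a') (-1) a := hasDerivAt_neg a
  cases R
  · change Fin 3 at c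
    fin_cases c
    · exact hb
    · exact hneg
    · exact (((hid.mul_const b).neg.sub_const t).congr_deriv (by simp [relaxVecDa]))
  · change Fin 2 at c
    fin_cases c
    · exact ((((hid.mul_const b).add_const (t ^ 2)).neg).congr_deriv (by simp [relaxVecDa]))
    · exact ((((hid.add_const t).mul_const (-b + t)).neg.add_const (t ^ 2)).congr_deriv
        (by simp [relaxVecDa]))
  · change Fin 3 at c
    fin_cases c
    · exact hb.sub_const t
    · exact hneg.sub_const t
    · exact ((((hid.sub_const t).mul_const (b + t)).neg).congr_deriv (by simp [relaxVecDa]))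
  · change Fin 3 at c
    fin_cases c
    · exact hb
    · exact hneg
    · change HasDerivAt (fun a' => relaxSU θ t a' b) _ a
      simp only [relaxSU_eq ht]
      have h := (hasDerivAt_extendReg hθ ((a + b) / t)).comp a ((hid.add_const b).div_const t)
      refine ((hid.sub_const b).sub (h.const_mul t)).congr_deriv ?_
      simp [relaxVecDa]; field_simp
  · change Fin 3 at c
    fin_cases c
    · exact hb
    · exact hneg
    · change HasDerivAt (fun a' => relaxKS t a' b) _ a
      simp only [relaxKS_eq]
      have h := (hasDerivAt_max_zero_sq (a - b - 2 * t)).comp a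
        ((hid.sub_const b).sub_const (2 * t))
      refine ((((hid.sub_const t).pow 2).add_const ((-b - t) ^ 2)).const_mul
        (-(1 / 2) : ℝ) |>.add (h.const_mul (1 / 2 : ℝ))).congr_deriv ?_
      simp [relaxVecDa]

lemma hasDerivAt_relaxVec_b {θ : ℝ → ℝ} (hθ : IsRegularization θ) (R : Scheme) {t : ℝ}
    (ht : 0 < t) (a b : ℝ) (c : Fin R.numIneq) :
    HasDerivAt (fun b' => relaxVec θ R t a b' c) (relaxVecDb θ R t a b c) b := by
  have hid := hasDerivAt_id b
  have ha : HasDerivAt (fun _ : ℝ => -a) 0 b := hasDerivAt_const b (-a)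
  have hneg : HasDerivAt (fun b' : ℝ => -b') (-1) b := hasDerivAt_neg b
  cases R
  · change Fin 3 at c
    fin_cases c
    · exact hid
    · exact ha
    · exact (((hid.const_mul a).neg.sub_const t).congr_deriv (by simp [relaxVecDb]))
  · change Fin 2 at c
    fin_cases c
    · exact ((((hid.const_mul a).add_const (t ^ 2)).neg).congr_deriv (by simp [relaxVecDb]))
    · exact ((((hneg.add_const t).const_mul (a + t)).neg.add_const (t ^ 2)).congr_deriv
        (by simp [relaxVecDb]))
  · change Fin 3 at c
    fin_cases c
    · exact hid.sub_const t
    · exact ha.sub_const t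
    · exact ((((hid.add_const t).const_mul (a - t)).neg).congr_deriv (by simp [relaxVecDb]))
  · change Fin 3 at c
    fin_cases c
    · exact hid
    · exact ha
    · change HasDerivAt (fun b' => relaxSU θ t a b') _ b
      simp only [relaxSU_eq ht]
      have h := (hasDerivAt_extendReg hθ ((a + b) / t)).comp b ((hid.const_add a).div_const t)
      refine ((hid.const_sub a).sub (h.const_mul t)).congr_deriv ?_
      simp [relaxVecDb]; field_simp
  · change Fin 3 at c
    fin_cases c
    · exact hid
    · exact ha
    · change HasDerivAt (fun b' => relaxKS t a b') _ b
      simp only [relaxKS_eq]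
      have h := (hasDerivAt_max_zero_sq (a - b - 2 * t)).comp b
        ((hid.const_sub a).sub_const (2 * t))
      refine ((((hneg.sub_const t).pow 2).const_add ((a - t) ^ 2)).const_mul
        (-(1 / 2) : ℝ) |>.add (h.const_mul (1 / 2 : ℝ))).congr_deriv ?_
      simp [relaxVecDb]; ring

/-! ### Multiplier pairs of a single relaxed complementarity condition. -/

/-- The pairs `(γ, ι)` that arise at `(a, b)` from complementary multipliers of a relaxation. -/
def RelaxPair (θ : ℝ → ℝ) (R : Scheme) (t a b γ ι : ℝ) : Prop :=
  ∃ lam : Fin R.numIneq → ℝ,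
    (∀ c, 0 ≤ lam c ∧ relaxVec θ R t a b c ≤ 0 ∧ lam c * relaxVec θ R t a b c = 0) ∧
    γ = -∑ c, lam c * relaxVecDb θ R t a b c ∧ ι = ∑ c, lam c * relaxVecDa θ R t a b c

/-- What is common to the pairs `(γ, ι)` of all relaxations. -/
structure PairBounds (t a b γ ι : ℝ) : Prop where
  sign : 0 ≤ γ * ι
  of_pos : t < a → t ≤ a + b → |ι| * a ≤ |γ| * (|b| + t)
  of_neg : b < -t → a + b ≤ -t → |γ| * |b| ≤ |ι| * (|a| + t)

namespace RelaxPair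

variable {θ : ℝ → ℝ} {R : Scheme} {t a b γ ι : ℝ}

/-- The admissible pairs form a cone; this permits rescaling of possibly unbounded multipliers. -/
lemma smul {r : ℝ} (hr : 0 ≤ r) (h : RelaxPair θ R t a b γ ι) :
    RelaxPair θ R t a b (r * γ) (r * ι) := by
  obtain ⟨lam, h, rfl, rfl⟩ := h
  refine ⟨fun c => r * lam c, fun c => ⟨mul_nonneg hr (h c).1, (h c).2.1, ?_⟩, ?_, ?_⟩
  · rw [mul_assoc, (h c).2.2, mul_zero]
  · simp only [mul_neg, Finset.mul_sum, mul_assoc]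
  · simp only [Finset.mul_sum, mul_assoc]

/-- Third-quadrant pairs coming from the two sign constraints alone. -/
lemma bounds_of_nonpos {l₀ l₁ : ℝ} (h₀ : 0 ≤ l₀) (h₁ : 0 ≤ l₁)
    (ht : 0 < t) (e₀ : l₀ * b = 0) (e₁ : l₁ * a = 0) : PairBounds t a b (-l₀) (-l₁) where
  sign := by nlinarith [mul_nonneg h₀ h₁]
  of_pos h _ := by
    have : l₁ = 0 := (mul_eq_zero.1 e₁).resolve_right (by linarith)
    rw [this]; simp; positivity
  of_neg h _ := by
    have : l₀ = 0 := (mul_eq_zero.1 e₀).resolve_right (by linarith)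
    rw [this]; simp; positivity

/-- If the product constraint has a positive multiplier, then `a * b = -t`, so `a > 0 > b`, both
sign constraints are inactive, and the pair is a positive multiple of `(a, -b)`. -/
lemma bounds_S (ht : 0 < t) (h : RelaxPair θ .S t a b γ ι) : PairBounds t a b γ ι := by
  obtain ⟨lam, h, rfl, rfl⟩ := h
  have h0 := h (0 : Fin 3)
  have h1 := h (1 : Fin 3)
  have h2 := h (2 : Fin 3)
  have eb : ∑ c, lam c * relaxVecDb θ .S t a b c
    = lam (0 : Fin 3) * 1 + lam (1 : Fin 3) * 0 + lam (2 : Fin 3) * (-a) := Fin.sum_univ_three _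
  have ea : ∑ c, lam c * relaxVecDa θ .S t a b c
    = lam (0 : Fin 3) * 0 + lam (1 : Fin 3) * (-1) + lam (2 : Fin 3) * (-b) := Fin.sum_univ_three _
  rw [ea, eb]
  generalize lam (0 : Fin 3) = l0 at *
  generalize lam (1 : Fin 3) = l1 at *
  generalize lam (2 : Fin 3) = l2 at *
  obtain ⟨p0, q0, e0⟩ : 0 ≤ l0 ∧ b ≤ 0 ∧ l0 * b = 0 := h0
  obtain ⟨p1, q1, e1⟩ : 0 ≤ l1 ∧ -a ≤ 0 ∧ l1 * (-a) = 0 := h1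
  obtain ⟨p2, q2, e2⟩ : 0 ≤ l2 ∧ -(a * b) - t ≤ 0 ∧ l2 * (-(a * b) - t) = 0 := h2
  rcases p2.eq_or_lt with rfl | hl
  · have := bounds_of_nonpos (a := a) p0 p1 ht e0 (by linarith)
    convert this using 1 <;> ring
  · have e : -(a * b) - t = 0 := (mul_eq_zero.1 e2).resolve_left hl.ne'
    have ha : 0 < a := lt_of_le_of_ne (by linarith) (by rintro rfl; linarith)
    have hb : b < 0 := lt_of_le_of_ne q0 (by rintro rfl; linarith)
    have : l0 = 0 := (mul_eq_zero.1 e0).resolve_right hb.ne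
    have : l1 = 0 := (mul_eq_zero.1 e1).resolve_right (by linarith)
    subst l0 l1
    have E1 : -(0 * 1 + 0 * 0 + l2 * -a) = l2 * a := by ring
    have E2 : 0 * 0 + 0 * -1 + l2 * -b = l2 * -b := by ring
    have H1 : |l2 * a| = l2 * a := abs_of_pos (by positivity)
    have H2 : |l2 * -b| = l2 * -b := abs_of_pos (mul_pos hl (by linarith))
    rw [E1, E2]
    have hp : 0 ≤ l2 * a * t := by positivity
    have hp2 : 0 ≤ l2 * -b * t := mul_nonneg (mul_nonneg hl.le (by linarith)) ht.le
    refine ⟨?_, fun _ _ => ?_, fun _ _ => ?_⟩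
    · exact mul_nonneg (by positivity) (mul_nonneg hl.le (by linarith))
    · rw [H1, H2, abs_of_neg hb]; linarith
    · rw [H1, H2, abs_of_neg hb, abs_of_pos ha]; linarith

lemma bounds_LF (ht : 0 < t) (h : RelaxPair θ .LF t a b γ ι) : PairBounds t a b γ ι := by
  obtain ⟨lam, h, rfl, rfl⟩ := h
  have h0 := h (0 : Fin 2)
  have h1 := h (1 : Fin 2)
  have eb : ∑ c, lam c * relaxVecDb θ .LF t a b c
    = lam (0 : Fin 2) * (-a) + lam (1 : Fin 2) * (a + t) := Fin.sum_univ_two _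
  have ea : ∑ c, lam c * relaxVecDa θ .LF t a b c
    = lam (0 : Fin 2) * (-b) + lam (1 : Fin 2) * (-(-b + t)) := Fin.sum_univ_two _
  rw [ea, eb]
  generalize lam (0 : Fin 2) = l0 at *
  generalize lam (1 : Fin 2) = l1 at *
  obtain ⟨p0, q0, e0⟩ : 0 ≤ l0 ∧ -(a * b + t ^ 2) ≤ 0 ∧ l0 * (-(a * b + t ^ 2)) = 0 := h0
  obtain ⟨p1, q1, e1⟩ : 0 ≤ l1 ∧ -((a + t) * (-b + t)) + t ^ 2 ≤ 0 ∧
    l1 * (-((a + t) * (-b + t)) + t ^ 2) = 0 := h1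
  have ht2 : 0 < t ^ 2 := by positivity
  -- The second constraint gives both factors the same sign; both negative would mean `a < -t` and
  -- `b > t`, contradicting `a * b ≥ -t ^ 2`.
  have hpos : 0 < a + t ∧ 0 < -b + t := by
    rcases pos_and_pos_or_neg_and_neg_of_mul_pos (a := a + t) (b := -b + t) (by linarith) with h | h
    · exact h
    · nlinarith [mul_pos_of_neg_of_neg h.1 h.2]
  obtain ⟨ha, hb⟩ := hpos
  rcases p1.eq_or_lt with rfl | hl
  · rcases p0.eq_or_lt with rfl | hl
    · simp only [zero_mul, add_zero, neg_zero]
      refine ⟨by simp, fun _ _ => by simp, fun _ _ => by simp⟩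
    have e : a * b + t ^ 2 = 0 := by
      have := (mul_eq_zero.1 e0).resolve_left hl.ne'; linarith
    have ha' : 0 < a := by
      by_contra hn
      nlinarith
    have hb' : b < 0 := by
      by_contra hn
      nlinarith
    have E1 : -(l0 * -a + 0 * (a + t)) = l0 * a := by ring
    have E2 : l0 * -b + 0 * -(-b + t) = l0 * -b := by ring
    have H1 : |l0 * a| = l0 * a := abs_of_pos (by positivity)
    have H2 : |l0 * -b| = l0 * -b := abs_of_pos (mul_pos hl (by linarith))
    rw [E1, E2]
    have hp : 0 ≤ l0 * a * t := by positivity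
    have hp2 : 0 ≤ l0 * -b * t := mul_nonneg (mul_nonneg hl.le (by linarith)) ht.le
    refine ⟨?_, fun _ _ => ?_, fun _ _ => ?_⟩
    · exact mul_nonneg (by positivity) (mul_nonneg hl.le (by linarith))
    · rw [H1, H2, abs_of_neg hb']; linarith
    · rw [H1, H2, abs_of_neg hb', abs_of_pos ha']; linarith
  · have e : -((a + t) * (-b + t)) + t ^ 2 = 0 := (mul_eq_zero.1 e1).resolve_left hl.ne'
    -- Both constraints cannot be active: subtraction gives `b = a + t`, and then `a ^ 2 + a * t + t
    -- ^ 2 = 0`.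
    have hl0 : l0 = 0 := by
      refine (mul_eq_zero.1 e0).resolve_right fun h => ?_
      have h3 : t * (a - b + t) = 0 := by linarith
      have h4 : a - b + t = 0 := (mul_eq_zero.1 h3).resolve_left ht.ne'
      obtain rfl : b = a + t := by linarith
      nlinarith [sq_nonneg (a + t / 2)]
    subst l0
    have E1 : -(0 * -a + l1 * (a + t)) = -(l1 * (a + t)) := by ring
    have E2 : 0 * -b + l1 * -(-b + t) = -(l1 * (-b + t)) := by ring
    have H1 : |l1 * (a + t)| = l1 * (a + t) := abs_of_pos (by positivity)
    have H2 : |l1 * (-b + t)| = l1 * (-b + t) := abs_of_pos (by positivity)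
    rw [E1, E2]
    refine ⟨?_, fun h _ => ?_, fun h _ => ?_⟩
    · rw [neg_mul_neg]; positivity
    · rw [abs_neg, abs_neg, H1, H2]
      calc l1 * (-b + t) * a ≤ l1 * (-b + t) * (a + t) := by gcongr; linarith
        _ = l1 * (a + t) * (-b + t) := by ring
        _ ≤ _ := by gcongr; exact neg_le_abs b
    · rw [abs_neg, abs_neg, H1, H2, abs_of_neg (by linarith)]
      calc l1 * (a + t) * -b ≤ l1 * (a + t) * (-b + t) := by gcongr; linarith
        _ = l1 * (-b + t) * (a + t) := by ring
        _ ≤ _ := by gcongr; exact le_abs_self a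

/-- An active product constraint means `a = t` or `b = -t`, and its gradient then has only one
nonzero component. If the other component of the pair is nonzero as well, its sign constraint is
active too, at a corner where both components are nonpositive. -/
lemma bounds_KDB (ht : 0 < t) (h : RelaxPair θ .KDB t a b γ ι) :
    PairBounds t a b γ ι ∧ (γ ≤ 0 ∨ ι ≤ 0) := by
  obtain ⟨lam, h, rfl, rfl⟩ := h
  have h0 := h (0 : Fin 3)
  have h1 := h (1 : Fin 3)
  have h2 := h (2 : Fin 3)
  have eb : ∑ c, lam c * relaxVecDb θ .KDB t a b c
    = lam (0 : Fin 3) * 1 + lam (1 : Fin 3) * 0 + lam (2 : Fin 3) * (-(a - t)) :=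
    Fin.sum_univ_three _
  have ea : ∑ c, lam c * relaxVecDa θ .KDB t a b c
    = lam (0 : Fin 3) * 0 + lam (1 : Fin 3) * (-1) + lam (2 : Fin 3) * (-(b + t)) :=
    Fin.sum_univ_three _
  rw [ea, eb]
  generalize lam (0 : Fin 3) = l0 at *
  generalize lam (1 : Fin 3) = l1 at *
  generalize lam (2 : Fin 3) = l2 at *
  obtain ⟨p0, q0, e0⟩ : 0 ≤ l0 ∧ b - t ≤ 0 ∧ l0 * (b - t) = 0 := h0
  obtain ⟨p1, q1, e1⟩ : 0 ≤ l1 ∧ -a - t ≤ 0 ∧ l1 * (-a - t) = 0 := h1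
  obtain ⟨p2, q2, e2⟩ : 0 ≤ l2 ∧ -((a - t) * (b + t)) ≤ 0 ∧ l2 * (-((a - t) * (b + t))) = 0 := h2
  have hd : l2 = 0 ∨ a = t ∨ b = -t := by
    rcases mul_eq_zero.1 e2 with h | h
    · exact .inl h
    · rcases mul_eq_zero.1 (neg_eq_zero.1 h) with h | h
      · exact .inr (.inl (by linarith))
      · exact .inr (.inr (by linarith))
  have hl0 : l0 = 0 ∨ b = t := (mul_eq_zero.1 e0).imp_right fun h => by linarith
  have hl1 : l1 = 0 ∨ a = -t := (mul_eq_zero.1 e1).imp_right fun h => by linarith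
  have E1 : -(l0 * 1 + l1 * 0 + l2 * -(a - t)) = -l0 + l2 * (a - t) := by ring
  have E2 : l0 * 0 + l1 * -1 + l2 * -(b + t) = -l1 - l2 * (b + t) := by ring
  rw [E1, E2]
  have key : -l0 + l2 * (a - t) = 0 ∨ -l1 - l2 * (b + t) = 0 ∨
      (-l0 + l2 * (a - t) ≤ 0 ∧ -l1 - l2 * (b + t) ≤ 0) := by
    rcases hd with rfl | rfl | rfl
    · right; right; constructor <;> linarith
    · rcases hl0 with rfl | rfl
      · left; simp
      · right; right; constructor
        · simpa
        · have : 0 ≤ l2 * (b + b) := by positivity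
          linarith
    · rcases hl1 with rfl | rfl
      · right; left; simp
      · right; right; constructor
        · have : 0 ≤ l2 * (t + t) := by positivity
          linarith
        · simpa
  refine ⟨⟨?_, fun h _ => ?_, fun h _ => ?_⟩, ?_⟩
  · rcases key with h | h | h
    · rw [h, zero_mul]
    · rw [h, mul_zero]
    · exact mul_nonneg_of_nonpos_of_nonpos h.1 h.2
  · have : -l1 - l2 * (b + t) = 0 := by
      rw [hl1.resolve_right (by linarith)]
      rcases hd with rfl | rfl | rfl
      · simp
      · exact absurd h (lt_irrefl _)
      · simp
    rw [this, abs_zero, zero_mul]; positivity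
  · have : -l0 + l2 * (a - t) = 0 := by
      rw [hl0.resolve_right (by linarith)]
      rcases hd with rfl | rfl | rfl
      · simp
      · simp
      · exact absurd h (lt_irrefl _)
    rw [this, abs_zero, zero_mul]; positivity
  · rcases key with h | h | h
    · exact .inl h.le
    · exact .inr h.le
    · exact .inl h.1

/-- For `t ≤ |a + b|` the slope `d` is `±1` and one component of the pair vanishes. In between,
activity of the smoothed constraint means `a - b = t * θ ((a + b) / t) > |a + b|`, hence `a > 0 >
b`; only its multiplier remains, and `|d| ≤ 1` makes both components nonnegative. -/
lemma bounds_SU (hθ : IsRegularization θ) (ht : 0 < t) (h : RelaxPair θ .SU t a b γ ι) :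
    PairBounds t a b γ ι := by
  obtain ⟨lam, h, rfl, rfl⟩ := h
  have h0 := h (0 : Fin 3)
  have h1 := h (1 : Fin 3)
  have h2 := h (2 : Fin 3)
  set d := extendRegDeriv θ ((a + b) / t) with hd
  have eb : ∑ c, lam c * relaxVecDb θ .SU t a b c
    = lam (0 : Fin 3) * 1 + lam (1 : Fin 3) * 0 + lam (2 : Fin 3) * (-1 - d) :=
    Fin.sum_univ_three _
  have ea : ∑ c, lam c * relaxVecDa θ .SU t a b c
    = lam (0 : Fin 3) * 0 + lam (1 : Fin 3) * (-1) + lam (2 : Fin 3) * (1 - d) :=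
    Fin.sum_univ_three _
  rw [ea, eb]
  generalize lam (0 : Fin 3) = l0 at *
  generalize lam (1 : Fin 3) = l1 at *
  generalize lam (2 : Fin 3) = l2 at *
  obtain ⟨p0, q0, e0⟩ : 0 ≤ l0 ∧ b ≤ 0 ∧ l0 * b = 0 := h0
  obtain ⟨p1, q1, e1⟩ : 0 ≤ l1 ∧ -a ≤ 0 ∧ l1 * (-a) = 0 := h1
  obtain ⟨p2, q2, e2⟩ : 0 ≤ l2 ∧ relaxSU θ t a b ≤ 0 ∧ l2 * relaxSU θ t a b = 0 := h2
  have E1 : -(l0 * 1 + l1 * 0 + l2 * (-1 - d)) = -l0 + l2 * (1 + d) := by ring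
  have E2 : l0 * 0 + l1 * -1 + l2 * (1 - d) = -l1 + l2 * (1 - d) := by ring
  rw [E1, E2]
  have c1 : a + b ≤ -t → -l0 + l2 * (1 + d) = 0 := fun h => by
    have : d = -1 := by
      rw [hd, extendRegDeriv, if_pos]
      rwa [div_le_iff₀ ht, neg_one_mul]
    rw [(mul_eq_zero.1 e0).resolve_right (by linarith), this]; ring
  have c2 : t ≤ a + b → -l1 + l2 * (1 - d) = 0 := fun h => by
    have h' : 1 ≤ (a + b) / t := by rwa [le_div_iff₀ ht, one_mul]
    have : d = 1 := by
      rw [hd, extendRegDeriv, if_neg (by linarith), if_pos h']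
    rw [(mul_eq_zero.1 e1).resolve_right (by linarith), this]; ring
  refine ⟨?_, fun _ h => ?_, fun _ h => ?_⟩
  · rcases le_or_gt (a + b) (-t) with h | h
    · rw [c1 h, zero_mul]
    rcases le_or_gt t (a + b) with h' | h'
    · rw [c2 h', mul_zero]
    rcases p2.eq_or_lt with rfl | hl
    · simp only [zero_mul, add_zero, neg_mul_neg]; positivity
    have hz : (a + b) / t ∈ Ioo (-1 : ℝ) 1 := by
      constructor
      · rw [lt_div_iff₀ ht]; linarith
      · rw [div_lt_iff₀ ht]; linarith
    have e := (mul_eq_zero.1 e2).resolve_left hl.ne'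
    rw [relaxSU, if_neg (by linarith), if_neg (by linarith)] at e
    have i1 := mul_lt_mul_of_pos_left (hθ.lt_apply hz) ht
    have i2 := mul_lt_mul_of_pos_left (hθ.neg_lt_apply hz) ht
    have i3 : t * ((a + b) / t) = a + b := by field_simp
    rw [mul_neg] at i2
    rw [i3] at i1 i2
    rw [(mul_eq_zero.1 e0).resolve_right (by linarith),
      (mul_eq_zero.1 e1).resolve_right (by linarith), neg_zero, zero_add, zero_add]
    have := neg_one_le_extendRegDeriv hθ ((a + b) / t)
    have := extendRegDeriv_le_one hθ ((a + b) / t)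
    exact mul_nonneg (mul_nonneg hl.le (by linarith)) (mul_nonneg hl.le (by linarith))
  · rw [c2 h, abs_zero, zero_mul]; positivity
  · rw [c1 h, abs_zero, zero_mul]; positivity

/-- An active third constraint lies on the upper branch with `a = t` or `b = -t`. There both sign
constraints are inactive and one partial derivative vanishes, so one component of the pair is zero.
-/
lemma bounds_KS (ht : 0 < t) (h : RelaxPair θ .KS t a b γ ι) :
    PairBounds t a b γ ι ∧ (γ ≤ 0 ∨ ι ≤ 0) := by
  obtain ⟨lam, h, rfl, rfl⟩ := h
  have h0 := h (0 : Fin 3)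
  have h1 := h (1 : Fin 3)
  have h2 := h (2 : Fin 3)
  set m := max (a - b - 2 * t) 0 with hm
  have eb : ∑ c, lam c * relaxVecDb θ .KS t a b c
    = lam (0 : Fin 3) * 1 + lam (1 : Fin 3) * 0 + lam (2 : Fin 3) * ((-b - t) - m) :=
    Fin.sum_univ_three _
  have ea : ∑ c, lam c * relaxVecDa θ .KS t a b c
    = lam (0 : Fin 3) * 0 + lam (1 : Fin 3) * (-1) + lam (2 : Fin 3) * (-(a - t) + m) :=
    Fin.sum_univ_three _
  rw [ea, eb]
  generalize lam (0 : Fin 3) = l0 at *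
  generalize lam (1 : Fin 3) = l1 at *
  generalize lam (2 : Fin 3) = l2 at *
  obtain ⟨p0, q0, e0⟩ : 0 ≤ l0 ∧ b ≤ 0 ∧ l0 * b = 0 := h0
  obtain ⟨p1, q1, e1⟩ : 0 ≤ l1 ∧ -a ≤ 0 ∧ l1 * (-a) = 0 := h1
  obtain ⟨p2, q2, e2⟩ : 0 ≤ l2 ∧ relaxKS t a b ≤ 0 ∧ l2 * relaxKS t a b = 0 := h2
  rcases p2.eq_or_lt with rfl | hl
  · have := bounds_of_nonpos (a := a) p0 p1 ht e0 (by linarith)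
    simp only [mul_one, mul_zero, zero_mul, add_zero, zero_add, mul_neg]
    exact ⟨this, .inl (by linarith)⟩
  have e := (mul_eq_zero.1 e2).resolve_left hl.ne'
  -- On the lower branch a zero value forces `a = t` and `b = -t`, which lies on the switching line
  -- and hence on the upper branch.
  have hs : 2 * t ≤ a - b := by
    by_contra hn
    rw [relaxKS, if_neg hn] at e
    have h1 : a - t = 0 := pow_eq_zero_iff two_ne_zero |>.1
      (by linarith [sq_nonneg (a - t), sq_nonneg (-b - t)])
    have h2 : -b - t = 0 := pow_eq_zero_iff two_ne_zero |>.1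
      (by linarith [sq_nonneg (a - t), sq_nonneg (-b - t)])
    linarith
  rw [relaxKS, if_pos hs] at e
  have hm' : m = a - b - 2 * t := max_eq_left (by linarith)
  rw [hm']
  rcases mul_eq_zero.1 e with h | h
  · obtain rfl : a = t := by linarith
    rw [(mul_eq_zero.1 e0).resolve_right (by linarith),
      (mul_eq_zero.1 e1).resolve_right (by linarith)]
    have E : -(0 * 1 + 0 * 0 + l2 * (-b - a - (a - b - 2 * a))) = 0 := by ring
    rw [E]
    refine ⟨⟨by simp, fun h => absurd h (lt_irrefl _), fun _ _ => ?_⟩, by simp⟩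
    rw [abs_zero, zero_mul]; positivity
  · obtain rfl : b = -t := by linarith
    rw [(mul_eq_zero.1 e0).resolve_right (by linarith),
      (mul_eq_zero.1 e1).resolve_right (by linarith)]
    have E : 0 * 0 + 0 * -1 + l2 * (-(a - t) + (a - -t - 2 * t)) = 0 := by ring
    rw [E]
    refine ⟨⟨by simp, fun _ _ => ?_, fun h => absurd h (lt_irrefl _)⟩, by simp⟩
    rw [abs_zero, zero_mul]; positivity

lemma bounds (hθ : IsRegularization θ) (ht : 0 < t) (h : RelaxPair θ R t a b γ ι) :
    PairBounds t a b γ ι := by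
  cases R
  · exact bounds_S ht h
  · exact bounds_LF ht h
  · exact (bounds_KDB ht h).1
  · exact bounds_SU hθ ht h
  · exact (bounds_KS ht h).1

lemma nonpos_or_nonpos (hR : R = .KDB ∨ R = .KS) (ht : 0 < t) (h : RelaxPair θ R t a b γ ι) :
    γ ≤ 0 ∨ ι ≤ 0 := by
  rcases hR with rfl | rfl
  · exact (bounds_KDB ht h).2
  · exact (bounds_KS ht h).2

end RelaxPair

lemma MSign.cSign {a b : ℝ} (h : MSign a b) : CSign a b := by
  rcases h with h | h
  · exact mul_nonneg_of_nonpos_of_nonpos h.1.le h.2.le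
  · exact h.ge

/-- This form is manifestly closed, so it passes to limits. -/
lemma mSign_iff {a b : ℝ} : MSign a b ↔ 0 ≤ a * b ∧ min a b ≤ 0 := by
  constructor
  · refine fun h => ⟨h.cSign, ?_⟩
    rcases h with h | h
    · exact (min_le_left _ _).trans h.1.le
    · rcases mul_eq_zero.1 h with h | h
      · exact (min_le_left _ _).trans h.le
      · exact (min_le_right _ _).trans h.le
  · rintro ⟨h, hm⟩
    rcases eq_or_ne (a * b) 0 with h0 | h0
    · exact .inr h0
    · rcases pos_and_pos_or_neg_and_neg_of_mul_pos (lt_of_le_of_ne h h0.symm) with h' | h'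
      · exact absurd hm (lt_min h'.1 h'.2).not_ge
      · exact .inl h'

/-! ### Limits of multiplier pairs as the relaxation parameter tends to zero. -/

section Limit

variable {θ : ℝ → ℝ} {R : Scheme} {t a b γ ι : ℕ → ℝ} {a' b' γ' ι' : ℝ}

/-- In the limit the estimate `|ι| * a ≤ |γ| * (|b| + t)` has right-hand side zero, because `γ`
stays bounded, while `a` stays away from zero. -/
lemma RelaxPair.limit_of_pos (hθ : IsRegularization θ) (ht : ∀ k, 0 < t k)
    (h : ∀ k, RelaxPair θ R (t k) (a k) (b k) (γ k) (ι k)) (htl : Tendsto t atTop (𝓝 0))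
    (ha : Tendsto a atTop (𝓝 a')) (hb : Tendsto b atTop (𝓝 b')) (hγ : Tendsto γ atTop (𝓝 γ'))
    (hι : Tendsto ι atTop (𝓝 ι')) (ha' : 0 < a') (hb' : b' = 0) : ι' = 0 := by
  subst hb'
  have e1 : ∀ᶠ k in atTop, t k < a k := htl.eventually_lt ha ha'
  have e2 : ∀ᶠ k in atTop, t k < a k + b k := htl.eventually_lt (ha.add hb) (by simpa)
  have hle : |ι'| * a' ≤ |γ'| * (|0| + 0) :=
    le_of_tendsto_of_tendsto (hι.abs.mul ha) (hγ.abs.mul (hb.abs.add htl)) <| by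
      filter_upwards [e1, e2] with k h1 h2
      exact ((h k).bounds hθ (ht k)).of_pos h1 h2.le
  rw [abs_zero, add_zero, mul_zero] at hle
  exact abs_eq_zero.1 (le_antisymm (nonpos_of_mul_nonpos_left hle ha') (abs_nonneg _))

lemma RelaxPair.limit_of_neg (hθ : IsRegularization θ) (ht : ∀ k, 0 < t k)
    (h : ∀ k, RelaxPair θ R (t k) (a k) (b k) (γ k) (ι k)) (htl : Tendsto t atTop (𝓝 0))
    (ha : Tendsto a atTop (𝓝 a')) (hb : Tendsto b atTop (𝓝 b')) (hγ : Tendsto γ atTop (𝓝 γ'))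
    (hι : Tendsto ι atTop (𝓝 ι')) (ha' : a' = 0) (hb' : b' < 0) : γ' = 0 := by
  subst ha'
  have e1 : ∀ᶠ k in atTop, b k < -t k := hb.eventually_lt htl.neg (by simpa)
  have e2 : ∀ᶠ k in atTop, a k + b k < -t k := (ha.add hb).eventually_lt htl.neg (by simpa)
  have hle : |γ'| * |b'| ≤ |ι'| * (|0| + 0) :=
    le_of_tendsto_of_tendsto (hγ.abs.mul hb.abs) (hι.abs.mul (ha.abs.add htl)) <| by
      filter_upwards [e1, e2] with k h1 h2
      exact ((h k).bounds hθ (ht k)).of_neg h1 h2.le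
  rw [abs_zero, add_zero, mul_zero] at hle
  exact abs_eq_zero.1 (le_antisymm (nonpos_of_mul_nonpos_left hle (abs_pos.2 hb'.ne))
    (abs_nonneg _))

lemma RelaxPair.limit_cSign (hθ : IsRegularization θ) (ht : ∀ k, 0 < t k)
    (h : ∀ k, RelaxPair θ R (t k) (a k) (b k) (γ k) (ι k)) (hγ : Tendsto γ atTop (𝓝 γ'))
    (hι : Tendsto ι atTop (𝓝 ι')) : CSign γ' ι' :=
  ge_of_tendsto' (hγ.mul hι) fun k => ((h k).bounds hθ (ht k)).sign

lemma RelaxPair.limit_mSign (hθ : IsRegularization θ) (hR : R = .KDB ∨ R = .KS)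
    (ht : ∀ k, 0 < t k)
    (h : ∀ k, RelaxPair θ R (t k) (a k) (b k) (γ k) (ι k)) (hγ : Tendsto γ atTop (𝓝 γ'))
    (hι : Tendsto ι atTop (𝓝 ι')) : MSign γ' ι' :=
  mSign_iff.2 ⟨RelaxPair.limit_cSign hθ ht h hγ hι,
    le_of_tendsto' (hγ.min hι) fun k => min_le_iff.2 ((h k).nonpos_or_nonpos hR (ht k))⟩

end Limit

/-! ### Gradients with parameters and Hessians of convex functions. -/

section Gradient

variable {E F : Type*} [NormedAddCommGroup E] [NormedSpace ℝ E]
  [NormedAddCommGroup F] [InnerProductSpace ℝ F] [CompleteSpace F]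

lemma contDiff_gradient_param {h : E → F → ℝ} {k : E → F} {m n : WithTop ℕ∞}
    (hh : ContDiff ℝ m (fun z : E × F => h z.1 z.2)) (hk : ContDiff ℝ n k) (hnm : n + 1 ≤ m) :
    ContDiff ℝ n (fun e => gradient (h e) (k e)) :=
  (InnerProductSpace.toDual ℝ F).symm.toContinuousLinearEquiv.contDiff.comp
    (ContDiff.fderiv (f := h) hh hk hnm)

lemma gradient_comp_real {h : F → ℝ} {r : ℝ → ℝ} {r' : ℝ} {x : F} (hr : HasDerivAt r r' (h x))
    (hh : DifferentiableAt ℝ h x) : gradient (fun z => r (h z)) x = r' • gradient h x := by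
  refine HasGradientAt.gradient (hasGradientAt_iff_hasFDerivAt.2 ?_)
  rw [map_smul, toDual_gradient]
  exact hr.comp_hasFDerivAt x hh.hasFDerivAt

lemma hasDerivAt_comp_line {h : F → ℝ} (hh : Differentiable ℝ h) (y v : F) (s : ℝ) :
    HasDerivAt (fun s : ℝ => h (y + s • v)) (inner ℝ (gradient h (y + s • v)) v) s := by
  rw [inner_gradient_left]
  have hl : HasDerivAt (fun s : ℝ => y + s • v) v s := by
    simpa using ((hasDerivAt_id s).smul_const v).const_add y
  exact (hh (y + s • v)).hasFDerivAt.comp_hasDerivAt s hl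

end Gradient

lemma gradient_comp_coord {d : ℕ} {r : ℝ → ℝ} {r' : ℝ} (u : Vec d) (i : Fin d)
    (hr : HasDerivAt r r' (u i)) : gradient (fun u' : Vec d => r (u' i)) u i = r' := by
  have hp : HasFDerivAt (fun u' : Vec d => u' i) (EuclideanSpace.proj (𝕜 := ℝ) i) u :=
    (EuclideanSpace.proj (𝕜 := ℝ) i).hasFDerivAt
  rw [gradient_comp_real (h := fun u' : Vec d => u' i) hr hp.differentiableAt]
  have h := inner_gradient_left (𝕜 := ℝ) (f := fun u' : Vec d => u' i) (x := u)
    (y := EuclideanSpace.single i 1)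
  rw [hp.fderiv, EuclideanSpace.inner_single_right] at h
  have h' : gradient (fun u' : Vec d => u' i) u i = 1 := by simpa using h
  rw [PiLp.smul_apply, h', smul_eq_mul, mul_one]

/-- The Hessian of a convex function is positive semidefinite. -/
lemma ConvexOn.hessian_nonneg {d : ℕ} {h : Vec d → ℝ} (hc : ConvexOn ℝ univ h)
    (h2 : ContDiff ℝ 2 h) (y β : Vec d) :
    0 ≤ inner ℝ (∑ l, β l • gradient (fun y' => gradient h y' l) y) β := by
  have hd : Differentiable ℝ h := h2.differentiable (by norm_num)
  have hg : ContDiff ℝ 1 (gradient h) :=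
    contDiff_gradient_param (h := fun _ : Vec d => h) (h2.comp contDiff_snd) contDiff_id
      (by norm_num)
  have hline : ConvexOn ℝ univ (fun s : ℝ => h (y + s • β)) := by
    refine ⟨convex_univ, fun s _ r _ a b ha hb hab => ?_⟩
    have := hc.2 (mem_univ (y + s • β)) (mem_univ (y + r • β)) ha hb hab
    convert this using 2
    rw [smul_add, smul_add, add_add_add_comm, ← add_smul, hab, one_smul, smul_smul, smul_smul,
      ← add_smul, smul_eq_mul, smul_eq_mul]
  have hd1 := hasDerivAt_comp_line hd y β
  -- The restriction to the line through `y` in direction `β` is convex, so its derivative is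
  -- monotone; the derivative of that at `0` is the quadratic form.
  have hmono : Monotone (fun s : ℝ => inner ℝ (gradient h (y + s • β)) β) := by
    have := hline.monotoneOn_deriv fun s _ => (hd1 s).differentiableAt
    rw [monotoneOn_univ] at this
    convert this using 1
    ext s
    exact (hd1 s).deriv.symm
  have hcoord : ∀ l, Differentiable ℝ (fun y' => gradient h y' l) := fun l =>
    ((EuclideanSpace.proj (𝕜 := ℝ) l).contDiff.comp hg).differentiable (by norm_num)
  have hder : HasDerivAt (fun s : ℝ => inner ℝ (gradient h (y + s • β)) β)
      (inner ℝ (∑ l, β l • gradient (fun y' => gradient h y' l) y) β) 0 := by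
    have e : (fun s : ℝ => inner ℝ (gradient h (y + s • β)) β) =
        fun s : ℝ => ∑ l, β l * gradient h (y + s • β) l := by
      ext s
      simp only [PiLp.inner_apply, RCLike.inner_apply, conj_trivial]
    rw [e, sum_inner]
    refine HasDerivAt.fun_sum fun l _ => ?_
    have := (hasDerivAt_comp_line (hcoord l) y β 0).const_mul (β l)
    rw [zero_smul, add_zero] at this
    rwa [real_inner_smul_left]
  rw [← hder.deriv]
  exact hmono.deriv_nonneg

/-! ### Excess and cluster points. -/

lemma infEDist_le_excess {m q : ℕ} {A B : Set (Vec m × Vec q)} {z : Vec m × Vec q} (hz : z ∈ A) :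
    Metric.infEDist z B ≤ excess A B := by
  refine le_trans ?_ (le_iSup₂ (f := fun z (_ : z ∈ A) => ⨅ w ∈ B,
    ENNReal.ofReal (Real.sqrt (‖z.1 - w.1‖ ^ 2 + ‖z.2 - w.2‖ ^ 2))) z hz)
  refine le_iInf₂ fun w hw => (Metric.infEDist_le_edist_of_mem hw).trans ?_
  -- The product type carries the maximum distance, which the Euclidean distance used in the excess
  -- dominates.
  rw [edist_dist, Prod.dist_eq, dist_eq_norm, dist_eq_norm]
  refine ENNReal.ofReal_le_ofReal (max_le ?_ ?_)
  · exact Real.le_sqrt_of_sq_le (by nlinarith [sq_nonneg ‖z.2 - w.2‖])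
  · exact Real.le_sqrt_of_sq_le (by nlinarith [sq_nonneg ‖z.1 - w.1‖])

/-- A sequence whose distance to a nonempty compact set tends to zero clusters in this set. -/
lemma IsCompact.exists_tendsto_subseq_of_infEDist {X : Type*} [PseudoEMetricSpace X] {K : Set X}
    (hK : IsCompact K) (hne : K.Nonempty) {z : ℕ → X}
    (hz : Tendsto (fun k => Metric.infEDist (z k) K) atTop (𝓝 0)) :
    ∃ w ∈ K, ∃ φ : ℕ → ℕ, StrictMono φ ∧ Tendsto (z ∘ φ) atTop (𝓝 w) := by
  choose v hv hvz using fun k => hK.exists_infEDist_eq_edist hne (z k)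
  obtain ⟨w, hw, φ, hφ, hlim⟩ := hK.tendsto_subseq hv
  refine ⟨w, hw, φ, hφ, tendsto_iff_edist_tendsto_0.2 ?_⟩
  have h1 : Tendsto (fun k => edist (z (φ k)) (v (φ k))) atTop (𝓝 0) := by
    simpa only [← hvz, Function.comp_def] using hz.comp hφ.tendsto_atTop
  have h2 : Tendsto (fun k => edist (z (φ k)) (v (φ k)) + edist (v (φ k)) w) atTop (𝓝 0) := by
    simpa using h1.add (tendsto_iff_edist_tendsto_0.1 hlim)
  exact tendsto_of_tendsto_of_tendsto_of_le_of_le tendsto_const_nhds h2 (fun _ => zero_le)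
    fun k => edist_triangle _ _ _

/-! ### Continuity and convexity of the bilevel data. -/

namespace BilevelData

variable {n m p q : ℕ} {P : BilevelData n m p q}

namespace Standing

lemma continuous_gradxF (hP : P.Standing) :
    Continuous fun z : Vec n × Vec m => gradient (fun x' => P.F x' z.2) z.1 :=
  (contDiff_gradient_param (n := 1) (m := 2) (h := fun (z : Vec n × Vec m) x' => P.F x' z.2)
    (hP.smooth_F.comp (contDiff_snd.prodMk (contDiff_snd.comp contDiff_fst))) contDiff_fst
    (by norm_num)).continuous

lemma continuous_gradyF (hP : P.Standing) :
    Continuous fun z : Vec n × Vec m => gradient (fun y' => P.F z.1 y') z.2 :=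
  (contDiff_gradient_param (n := 1) (m := 2) (h := fun (z : Vec n × Vec m) y' => P.F z.1 y')
    (hP.smooth_F.comp ((contDiff_fst.comp contDiff_fst).prodMk contDiff_snd)) contDiff_snd
    (by norm_num)).continuous

lemma continuous_gradG (hP : P.Standing) (j : Fin p) : Continuous (gradient (P.G j)) :=
  (contDiff_gradient_param (n := 1) (m := 2) (h := fun _ : Vec n => P.G j)
    ((hP.smooth_G j).comp contDiff_snd) contDiff_id (by norm_num)).continuous

lemma continuous_gradxg (hP : P.Standing) (i : Fin q) :
    Continuous fun z : Vec n × Vec m => P.gradxg i z.1 z.2 :=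
  (contDiff_gradient_param (n := 1) (m := 3) (h := fun (z : Vec n × Vec m) x' => P.g i x' z.2)
    ((hP.smooth_g i).comp (contDiff_snd.prodMk (contDiff_snd.comp contDiff_fst))) contDiff_fst
    (by norm_num)).continuous

lemma continuous_gradyg (hP : P.Standing) (i : Fin q) :
    Continuous fun z : Vec n × Vec m => P.gradyg i z.1 z.2 :=
  (contDiff_gradient_param (n := 1) (m := 3) (h := fun (z : Vec n × Vec m) y' => P.g i z.1 y')
    ((hP.smooth_g i).comp ((contDiff_fst.comp contDiff_fst).prodMk contDiff_snd)) contDiff_snd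
    (by norm_num)).continuous

lemma continuous_g (hP : P.Standing) (i : Fin q) :
    Continuous fun z : Vec n × Vec m => P.g i z.1 z.2 :=
  (hP.smooth_g i).continuous

lemma contDiff_lagr (hP : P.Standing) :
    ContDiff ℝ 3 fun z : Vec n × Vec m × Vec q => P.lagr z.1 z.2.1 z.2.2 := by
  have hxy : ContDiff ℝ 3 fun z : Vec n × Vec m × Vec q => (z.1, z.2.1) := by fun_prop
  refine (hP.smooth_f.comp hxy).add (ContDiff.sum fun i _ => ?_)
  refine ContDiff.mul ?_ ((hP.smooth_g i).comp hxy)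
  exact (EuclideanSpace.proj (𝕜 := ℝ) i).contDiff.comp (contDiff_snd.comp contDiff_snd)

lemma contDiff_gradLagr (hP : P.Standing) (l : Fin m) :
    ContDiff ℝ 2 fun z : Vec n × Vec m × Vec q => P.gradLagr z.1 z.2.1 z.2.2 l := by
  refine (EuclideanSpace.proj (𝕜 := ℝ) l).contDiff.comp ?_
  refine contDiff_gradient_param (m := 3)
    (h := fun (z : Vec n × Vec m × Vec q) y' => P.lagr z.1 y' z.2.2)
    (k := fun z : Vec n × Vec m × Vec q => z.2.1) ?_ (by fun_prop) (by norm_num)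
  exact hP.contDiff_lagr.comp (f := fun w : (Vec n × Vec m × Vec q) × Vec m =>
    (w.1.1, w.2, w.1.2.2)) (by fun_prop)

lemma continuous_gradxLagrT (hP : P.Standing) :
    Continuous fun z : (Vec n × Vec m × Vec q) × Vec m =>
      P.gradxLagrT z.1.1 z.1.2.1 z.1.2.2 z.2 := by
  refine continuous_finsetSum _ fun l _ => Continuous.fun_smul ?_ ?_
  · exact (EuclideanSpace.proj (𝕜 := ℝ) l).continuous.comp continuous_snd
  · have := contDiff_gradient_param (n := 1) (m := 2)
      (h := fun (z : Vec n × Vec m × Vec q) x' => P.gradLagr x' z.2.1 z.2.2 l)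
      (k := fun z : Vec n × Vec m × Vec q => z.1)
      ((hP.contDiff_gradLagr l).comp (f := fun w : (Vec n × Vec m × Vec q) × Vec n =>
        (w.2, w.1.2.1, w.1.2.2)) (by fun_prop)) (by fun_prop) (by norm_num)
    exact this.continuous.comp continuous_fst

lemma continuous_gradyLagrT (hP : P.Standing) :
    Continuous fun z : (Vec n × Vec m × Vec q) × Vec m =>
      P.gradyLagrT z.1.1 z.1.2.1 z.1.2.2 z.2 := by
  refine continuous_finsetSum _ fun l _ => Continuous.fun_smul ?_ ?_
  · exact (EuclideanSpace.proj (𝕜 := ℝ) l).continuous.comp continuous_snd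
  · have := contDiff_gradient_param (n := 1) (m := 2)
      (h := fun (z : Vec n × Vec m × Vec q) y' => P.gradLagr z.1 y' z.2.2 l)
      (k := fun z : Vec n × Vec m × Vec q => z.2.1)
      ((hP.contDiff_gradLagr l).comp (f := fun w : (Vec n × Vec m × Vec q) × Vec m =>
        (w.1.1, w.2, w.1.2.2)) (by fun_prop)) (by fun_prop) (by norm_num)
    exact this.continuous.comp continuous_fst

lemma inner_gradyLagrT_nonneg (hP : P.Standing) {x : Vec n} (hx : x ∈ P.X) (y : Vec m) {u : Vec q}
    (hu : ∀ i, 0 ≤ u i) (β : Vec m) : 0 ≤ inner ℝ (P.gradyLagrT x y u β) β := by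
  have hc : ConvexOn ℝ univ (fun y' => P.lagr x y' u) := by
    refine (hP.convex_f x hx).add ?_
    have h := Finset.sum_induction (s := Finset.univ) (fun i y' => u i * P.g i x y')
      (ConvexOn ℝ univ) (fun _ _ => ConvexOn.add) (convexOn_const 0 convex_univ)
      (fun i _ => (hP.convex_g x hx i).smul (hu i))
    rwa [Finset.sum_fn] at h
  refine hc.hessian_nonneg (ContDiff.of_le (n := 3) ?_ (by norm_num)) y β
  exact hP.contDiff_lagr.comp (f := fun y' : Vec m => (x, y', u)) (by fun_prop)

end Standing

lemma mul_eq_zero_of_mem_D {x : Vec n} {y : Vec m} {u : Vec q} (h : (y, u) ∈ P.D x) (i : Fin q) :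
    u i * P.g i x y = 0 :=
  (Finset.sum_eq_zero_iff_of_nonpos fun i _ =>
    mul_nonpos_of_nonneg_of_nonpos (h.2.1 i) (h.2.2.1 i)).1 h.2.2.2 i (Finset.mem_univ i)

lemma mem_index_of_mem_D {x : Vec n} {y : Vec m} {u : Vec q} (h : (y, u) ∈ P.D x) (i : Fin q) :
    i ∈ P.eta x y u ∨ i ∈ P.biactive x y u ∨ i ∈ P.nu x y u := by
  rcases (h.2.1 i).eq_or_lt with h0 | h0
  · rcases (h.2.2.1 i).eq_or_lt with h1 | h1
    · exact .inr (.inl ⟨h0.symm, h1⟩)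
    · exact .inl ⟨h0.symm, h1⟩
  · exact .inr (.inr ⟨h0, (mul_eq_zero.1 (mul_eq_zero_of_mem_D h i)).resolve_left h0.ne'⟩)

/-- By lower-level convexity the C-type and the M-type multiplier set coincide. -/
lemma Standing.multY_cSign_subset (hP : P.Standing) {x : Vec n} (hx : x ∈ P.X) {y : Vec m}
    {u : Vec q} (h : (y, u) ∈ P.D x) : P.multY CSign x y u ⊆ P.multY MSign x y u := by
  rintro ⟨β, γ⟩ ⟨⟨h1, h2, h3⟩, heq⟩
  refine ⟨⟨h1, h2, fun i hi => .inr ?_⟩, heq⟩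
  dsimp only at h1 h2 h3 heq ⊢
  have hnn : ∀ i ∈ Finset.univ, 0 ≤ γ i * inner ℝ (P.gradyg i x y) β := fun i _ => by
    rcases mem_index_of_mem_D h i with hi | hi | hi
    · rw [h2 i hi, zero_mul]
    · exact h3 i hi
    · rw [h1 i hi, mul_zero]
  -- Pairing the `y`-equation with `β` turns it into the Hessian form of the Lagrangian plus a sum
  -- of nonnegative products, with total zero.
  have hin := congrArg (fun v => inner ℝ v β) heq
  simp only [inner_add_left, sum_inner, real_inner_smul_left, inner_zero_left] at hin
  have h0 : ∑ i, γ i * inner ℝ (P.gradyg i x y) β = 0 :=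
    le_antisymm (by linarith [hP.inner_gradyLagrT_nonneg hx y h.2.1 β]) (Finset.sum_nonneg hnn)
  exact (Finset.sum_eq_zero_iff_of_nonneg hnn).1 h0 i (Finset.mem_univ i)

lemma gradxLagrT_smul (x : Vec n) (y : Vec m) (u : Vec q) (r : ℝ) (β : Vec m) :
    P.gradxLagrT x y u (r • β) = r • P.gradxLagrT x y u β := by
  simp [gradxLagrT, Finset.smul_sum, smul_smul]

lemma gradyLagrT_smul (x : Vec n) (y : Vec m) (u : Vec q) (r : ℝ) (β : Vec m) :
    P.gradyLagrT x y u (r • β) = r • P.gradyLagrT x y u β := by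
  simp [gradyLagrT, Finset.smul_sum, smul_smul]

lemma SignConds.mono {sgn sgn' : ℝ → ℝ → Prop} (hs : ∀ a b, sgn a b → sgn' a b)
    {x : Vec n} {y : Vec m} {u : Vec q} {β : Vec m} {γ : Fin q → ℝ}
    (h : P.SignConds sgn x y u β γ) : P.SignConds sgn' x y u β γ :=
  ⟨h.1, h.2.1, fun i hi => hs _ _ (h.2.2 i hi)⟩

lemma SignConds.smul {sgn : ℝ → ℝ → Prop} {r : ℝ} (hs : ∀ a b, sgn a b → sgn (r * a) (r * b))
    {x : Vec n} {y : Vec m} {u : Vec q} {β : Vec m} {γ : Fin q → ℝ}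
    (h : P.SignConds sgn x y u β γ) : P.SignConds sgn x y u (r • β) (r • γ) := by
  refine ⟨fun i hi => ?_, fun i hi => ?_, fun i hi => ?_⟩
  · rw [inner_smul_right, h.1 i hi, mul_zero]
  · rw [Pi.smul_apply, h.2.1 i hi, smul_zero]
  · rw [inner_smul_right]; exact hs _ _ (h.2.2 i hi)

end BilevelData

/-! ### From relaxed stationarity to a Fritz John system in the limit. -/

namespace BilevelData

variable {n m p q : ℕ} {P : BilevelData n m p q} {θ : ℝ → ℝ} {R : Scheme}

/-- The stationarity system of a relaxed problem, with the multipliers `λ_i` condensed into pairs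
`(γ_i, ∇_y g_i β)`. -/
lemma IsRelaxedStationary.exists_relaxPair (hP : P.Standing) (hθ : IsRegularization θ) {t : ℝ}
    (ht : 0 < t) {x : Vec n} (h : P.IsRelaxedStationary θ R t x) :
    ∃ (y : Vec m) (u : Vec q) (α : Fin p → ℝ) (β : Vec m) (γ : Fin q → ℝ),
      (y, u) ∈ P.SR θ R t x ∧
      gradient (fun x' => P.F x' y) x + ∑ j, α j • gradient (P.G j) x + P.gradxLagrT x y u β
        + ∑ i, γ i • P.gradxg i x y = 0 ∧
      gradient (fun y' => P.F x y') y + P.gradyLagrT x y u β + ∑ i, γ i • P.gradyg i x y = 0 ∧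
      (∀ j, 0 ≤ α j ∧ P.G j x ≤ 0 ∧ α j * P.G j x = 0) ∧
      ∀ i, RelaxPair θ R t (u i) (P.g i x y) (γ i) (inner ℝ (P.gradyg i x y) β) := by
  obtain ⟨y, u, α, β, lam, hS, hx, hy, hu, hα, hlam⟩ := h
  have dx : ∀ i, DifferentiableAt ℝ (fun x' => P.g i x' y) x := fun i =>
    (((hP.smooth_g i).comp (f := fun x' : Vec n => (x', y)) (by fun_prop)).differentiable
      (by norm_num)) x
  have dy : ∀ i, DifferentiableAt ℝ (fun y' => P.g i x y') y := fun i =>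
    (((hP.smooth_g i).comp (f := fun y' : Vec m => (x, y')) (by fun_prop)).differentiable
      (by norm_num)) y
  have ex : ∀ i c, gradient (fun x' => P.phi θ R t i c x' y u) x =
      relaxVecDb θ R t (u i) (P.g i x y) c • P.gradxg i x y := fun i c =>
    gradient_comp_real (h := fun x' => P.g i x' y)
      (hasDerivAt_relaxVec_b hθ R ht (u i) (P.g i x y) c) (dx i)
  have ey : ∀ i c, gradient (fun y' => P.phi θ R t i c x y' u) y =
      relaxVecDb θ R t (u i) (P.g i x y) c • P.gradyg i x y := fun i c =>
    gradient_comp_real (hasDerivAt_relaxVec_b hθ R ht (u i) (P.g i x y) c) (dy i)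
  have eu : ∀ i c, gradient (fun u' => P.phi θ R t i c x y u') u i =
      relaxVecDa θ R t (u i) (P.g i x y) c := fun i c =>
    gradient_comp_coord u i (hasDerivAt_relaxVec_a hθ R ht (u i) (P.g i x y) c)
  simp only [ex, ey, eu, smul_smul, ← Finset.sum_smul] at hx hy hu
  have nx : P.gradxLagrT x y u (-β) = -P.gradxLagrT x y u β := by
    simpa using gradxLagrT_smul (P := P) x y u (-1) β
  have ny : P.gradyLagrT x y u (-β) = -P.gradyLagrT x y u β := by
    simpa using gradyLagrT_smul (P := P) x y u (-1) β
  -- The relaxed system carries `-βᵀ 𝓛` and the limiting one `+βᵀ 𝓛`, hence the reversed sign.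
  refine ⟨y, u, α, -β, fun i => -∑ c, lam i c * relaxVecDb θ R t (u i) (P.g i x y) c, hS,
    ?_, ?_, hα, fun i => ⟨lam i, hlam i, rfl, ?_⟩⟩
  · simpa only [nx, neg_smul, Finset.sum_neg_distrib, sub_eq_add_neg] using hx
  · simpa only [ny, neg_smul, Finset.sum_neg_distrib, sub_eq_add_neg] using hy
  · rw [inner_neg_right]
    linarith [hu i]

/-- Fritz John type conditions in the limit of stationary points of the relaxed problems. -/
lemma exists_fritzJohn_limit (hP : P.Standing) (hθ : IsRegularization θ)
    {t : ℕ → ℝ} (ht : ∀ k, 0 < t k) (htl : Tendsto t atTop (𝓝 0)) {x : ℕ → Vec n} {xbar : Vec n}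
    (hx : ∀ k, P.IsRelaxedStationary θ R (t k) (x k)) (hxl : Tendsto x atTop (𝓝 xbar))
    (hex : Tendsto (fun k => excess (P.SR θ R (t k) (x k)) (P.Sp xbar)) atTop (𝓝 0))
    (hne : (P.Sp xbar).Nonempty) (hcomp : IsCompact (P.Sp xbar)) :
    (∀ j, P.G j xbar ≤ 0) ∧
    ∃ (y : Vec m) (u : Vec q) (s : ℝ) (α : Fin p → ℝ) (β : Vec m) (γ : Fin q → ℝ),
      (y, u) ∈ P.Sp xbar ∧ (s, α, β, γ) ≠ 0 ∧ 0 ≤ s ∧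
      s • gradient (fun x' => P.F x' y) xbar + ∑ j, α j • gradient (P.G j) xbar
        + P.gradxLagrT xbar y u β + ∑ i, γ i • P.gradxg i xbar y = 0 ∧
      s • gradient (fun y' => P.F xbar y') y + P.gradyLagrT xbar y u β
        + ∑ i, γ i • P.gradyg i xbar y = 0 ∧
      (∀ j, 0 ≤ α j) ∧ ∑ j, α j * P.G j xbar = 0 ∧
      P.SignConds CSign xbar y u β γ ∧
      (R = .KDB ∨ R = .KS → P.SignConds MSign xbar y u β γ) := by
  choose y u α β γ hS hgx hgy hα hpair using fun k => (hx k).exists_relaxPair hP hθ (ht k)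
  have hinf : Tendsto (fun k => Metric.infEDist (y k, u k) (P.Sp xbar)) atTop (𝓝 0) :=
    tendsto_of_tendsto_of_tendsto_of_le_of_le tendsto_const_nhds hex (fun _ => zero_le)
      fun k => infEDist_le_excess (hS k)
  obtain ⟨⟨yb, ub⟩, hyu, φ, hφ, hφl⟩ := hcomp.exists_tendsto_subseq_of_infEDist hne hinf
  -- The leading `1` is the multiplier of the objective. It keeps the vector nonzero, and after
  -- normalization its limit is `s`.
  set w : ℕ → ℝ × (Fin p → ℝ) × Vec m × (Fin q → ℝ) := fun k => (1, α k, β k, γ k) with hw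
  have hw0 : ∀ k, w k ≠ 0 := fun k h => one_ne_zero (congrArg Prod.fst h)
  have hsph : ∀ k, ‖w k‖⁻¹ • w k ∈ Metric.sphere
      (0 : ℝ × (Fin p → ℝ) × Vec m × (Fin q → ℝ)) 1 := fun k => by
    rw [mem_sphere_zero_iff_norm, norm_smul, norm_inv, norm_norm,
      inv_mul_cancel₀ (norm_ne_zero_iff.2 (hw0 k))]
  obtain ⟨⟨s', α', β', γ'⟩, hv, ψ, hψ, hψl⟩ :=
    (isCompact_sphere _ _).tendsto_subseq fun k => hsph (φ k)
  set κ : ℕ → ℕ := φ ∘ ψ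
  have hκ : Tendsto κ atTop atTop := hφ.tendsto_atTop.comp hψ.tendsto_atTop
  set r : ℕ → ℝ := fun k => ‖w (κ k)‖⁻¹
  have hr : ∀ k, 0 ≤ r k := fun k => inv_nonneg.2 (norm_nonneg _)
  have lx : Tendsto (fun k => x (κ k)) atTop (𝓝 xbar) := hxl.comp hκ
  have lt : Tendsto (fun k => t (κ k)) atTop (𝓝 0) := htl.comp hκ
  have lyu : Tendsto (fun k => (y (κ k), u (κ k))) atTop (𝓝 (yb, ub)) :=
    hφl.comp hψ.tendsto_atTop
  have ly : Tendsto (fun k => y (κ k)) atTop (𝓝 yb) := lyu.fst_nhds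
  have lu : Tendsto (fun k => u (κ k)) atTop (𝓝 ub) := lyu.snd_nhds
  have lv : Tendsto (fun k => r k • w (κ k)) atTop (𝓝 (s', α', β', γ')) := hψl
  have lr : Tendsto r atTop (𝓝 s') := by
    simpa [hw] using lv.fst_nhds
  have lα : Tendsto (fun k => r k • α (κ k)) atTop (𝓝 α') := lv.snd_nhds.fst_nhds
  have lβ : Tendsto (fun k => r k • β (κ k)) atTop (𝓝 β') := lv.snd_nhds.snd_nhds.fst_nhds
  have lγ : Tendsto (fun k => r k • γ (κ k)) atTop (𝓝 γ') := lv.snd_nhds.snd_nhds.snd_nhds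
  have lαj := fun j => tendsto_pi_nhds.1 lα j
  have lγi := fun i => tendsto_pi_nhds.1 lγ i
  have lui : ∀ i, Tendsto (fun k => u (κ k) i) atTop (𝓝 (ub i)) := fun i =>
    ((EuclideanSpace.proj (𝕜 := ℝ) i).continuous.tendsto ub).comp lu
  have lxy : Tendsto (fun k => (x (κ k), y (κ k))) atTop (𝓝 (xbar, yb)) := lx.prodMk_nhds ly
  have lxyuβ : Tendsto (fun k => ((x (κ k), y (κ k), u (κ k)), r k • β (κ k))) atTop
      (𝓝 ((xbar, yb, ub), β')) := (lx.prodMk_nhds lyu).prodMk_nhds lβ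
  have lg := fun i => ((hP.continuous_g i).tendsto (xbar, yb)).comp lxy
  have lgx := fun i => ((hP.continuous_gradxg i).tendsto (xbar, yb)).comp lxy
  have lgy := fun i => ((hP.continuous_gradyg i).tendsto (xbar, yb)).comp lxy
  have lG := fun j => ((hP.smooth_G j).continuous.tendsto xbar).comp lx
  have lgG := fun j => ((hP.continuous_gradG j).tendsto xbar).comp lx
  have lin : ∀ i, Tendsto (fun k => inner ℝ (P.gradyg i (x (κ k)) (y (κ k))) (r k • β (κ k)))
      atTop (𝓝 (inner ℝ (P.gradyg i xbar yb) β')) := fun i => (lgy i).inner lβ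
  have hpair' : ∀ i k, RelaxPair θ R (t (κ k)) (u (κ k) i) (P.g i (x (κ k)) (y (κ k)))
      ((r k • γ (κ k)) i) (inner ℝ (P.gradyg i (x (κ k)) (y (κ k))) (r k • β (κ k))) :=
    fun i k => by
      rw [inner_smul_right]
      exact (hpair (κ k) i).smul (hr k)
  have hnu : ∀ i ∈ P.nu xbar yb ub, inner ℝ (P.gradyg i xbar yb) β' = 0 := fun i hi =>
    RelaxPair.limit_of_pos hθ (fun k => ht (κ k)) (hpair' i) lt (lui i) (lg i) (lγi i) (lin i)
      hi.1 hi.2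
  have heta : ∀ i ∈ P.eta xbar yb ub, γ' i = 0 := fun i hi =>
    RelaxPair.limit_of_neg hθ (fun k => ht (κ k)) (hpair' i) lt (lui i) (lg i) (lγi i) (lin i)
      hi.1 hi.2
  refine ⟨fun j => le_of_tendsto' (lG j) fun k => (hα (κ k) j).2.1, yb, ub, s', α', β', γ', hyu,
    fun h => ?_, ge_of_tendsto' lr hr, ?_, ?_,
    fun j => ge_of_tendsto' (lαj j) fun k => mul_nonneg (hr k) (hα (κ k) j).1, ?_,
    ⟨hnu, heta, fun i _ => RelaxPair.limit_cSign hθ (fun k => ht (κ k)) (hpair' i) (lγi i) (lin i)⟩,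
    fun hR => ⟨hnu, heta, fun i _ =>
      RelaxPair.limit_mSign hθ hR (fun k => ht (κ k)) (hpair' i) (lγi i) (lin i)⟩⟩
  -- The limit lies on the unit sphere, so it is not zero.
  · rw [h] at hv
    simp at hv
  · have h1 := lr.smul ((hP.continuous_gradxF.tendsto (xbar, yb)).comp lxy)
    have h2 := tendsto_finsetSum Finset.univ fun j _ => (lαj j).smul (lgG j)
    have h3 := (hP.continuous_gradxLagrT.tendsto ((xbar, yb, ub), β')).comp lxyuβ
    have h4 := tendsto_finsetSum Finset.univ fun i _ => (lγi i).smul (lgx i)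
    refine tendsto_nhds_unique (((h1.add h2).add h3).add h4)
      (tendsto_const_nhds.congr fun k => ?_)
    have := congrArg (fun v => r k • v) (hgx (κ k))
    simp only [smul_zero, smul_add, Finset.smul_sum, smul_smul, ← gradxLagrT_smul] at this
    exact this.symm
  · have h1 := lr.smul ((hP.continuous_gradyF.tendsto (xbar, yb)).comp lxy)
    have h3 := (hP.continuous_gradyLagrT.tendsto ((xbar, yb, ub), β')).comp lxyuβ
    have h4 := tendsto_finsetSum Finset.univ fun i _ => (lγi i).smul (lgy i)
    refine tendsto_nhds_unique ((h1.add h3).add h4) (tendsto_const_nhds.congr fun k => ?_)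
    have := congrArg (fun v => r k • v) (hgy (κ k))
    simp only [smul_zero, smul_add, Finset.smul_sum, smul_smul, ← gradyLagrT_smul] at this
    exact this.symm
  · have h1 := tendsto_finsetSum Finset.univ fun j _ => (lαj j).mul (lG j)
    refine tendsto_nhds_unique h1 (tendsto_const_nhds.congr fun k => ?_)
    refine (Finset.sum_eq_zero fun j _ => ?_).symm
    change r k * α (κ k) j * P.G j (x (κ k)) = 0
    rw [mul_assoc, (hα (κ k) j).2.2, mul_zero]

end BilevelData

/-! ### Positivity of the objective multiplier and normalization. -/

lemma CSign.smul {r a b : ℝ} (h : CSign a b) : CSign (r * a) (r * b) := by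
  have : r * a * (r * b) = r ^ 2 * (a * b) := by ring
  rw [CSign, this]
  exact mul_nonneg (sq_nonneg r) h

lemma MSign.smul {r a b : ℝ} (hr : 0 < r) (h : MSign a b) : MSign (r * a) (r * b) := by
  rcases h with h | h
  · exact .inl ⟨mul_neg_of_pos_of_neg hr h.1, mul_neg_of_pos_of_neg hr h.2⟩
  · exact .inr (by rw [mul_mul_mul_comm, h, mul_zero])

theorem theorem4p3 {n m p q : ℕ} (P : BilevelData n m p q) (hP : P.Standing)
    (θ : ℝ → ℝ) (hθ : IsRegularization θ) (R : Scheme)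
    (t : ℕ → ℝ) (ht_pos : ∀ k, 0 < t k) (ht_lim : Tendsto t atTop (𝓝 0))
    (x : ℕ → Vec n) (xbar : Vec n)
    (hx : ∀ k, P.IsRelaxedStationary θ R (t k) (x k))
    (hx_lim : Tendsto x atTop (𝓝 xbar))
    (h_excess : Tendsto (fun k => excess (P.SR θ R (t k) (x k)) (P.Sp xbar)) atTop (𝓝 0))
    (h_reg : P.UpperRegular xbar)
    (h_ne : (P.Sp xbar).Nonempty) (h_comp : IsCompact (P.Sp xbar)) :
    ((R = Scheme.S ∨ R = Scheme.LF ∨ R = Scheme.SU) →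
      (∀ y u, (y, u) ∈ P.Sp xbar →
        P.QualOne MSign xbar y u ∧ P.QualTwo MSign xbar y u) →
      P.IsCStationary xbar) ∧
    ((R = Scheme.KDB ∨ R = Scheme.KS) →
      (∀ y u, (y, u) ∈ P.Sp xbar →
        P.QualOne CSign xbar y u ∧ P.QualTwo CSign xbar y u) →
      P.IsMStationary xbar) := by
  obtain ⟨hG, y, u, s, α, β, γ, hyu, hne, hs, hgx, hgy, hα, hαG, hC, hM⟩ :=
    BilevelData.exists_fritzJohn_limit hP hθ ht_pos ht_lim hx hx_lim h_excess h_ne h_comp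
  -- Convexity at `xbar`, which is feasible by `hG`, upgrades C-type signs to M-type signs once the
  -- objective term is absent.
  have hmultM : s = 0 → (β, γ) ∈ P.multY MSign xbar y u := fun h0 => by
    refine hP.multY_cSign_subset hG hyu.1 ⟨hC, ?_⟩
    simpa only [h0, zero_smul, zero_add] using hgy
  have hs_pos : ∀ sgn, (s = 0 → (β, γ) ∈ P.multY sgn xbar y u) →
      P.QualOne sgn xbar y u → P.QualTwo sgn xbar y u → 0 < s := fun sgn hmem h1 h2 => by
    refine lt_of_le_of_ne hs fun h0 => hne ?_
    have hm := hmem h0.symm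
    have e := h2 β γ hm
    have hα0 : α = 0 := by
      refine h_reg α ?_ hα hαG
      rwa [← h0, zero_smul, zero_add, add_assoc, e, add_zero] at hgx
    obtain ⟨hβ0, hγ0⟩ := h1 β γ ⟨hm.1, e, hm.2⟩
    rw [← h0, hα0, hβ0, hγ0]
    rfl
  have final : ∀ sgn, 0 < s → P.SignConds sgn xbar y u (s⁻¹ • β) (s⁻¹ • γ) →
      P.IsStationaryWith sgn xbar := fun sgn hs' hsgn => by
    refine ⟨y, u, s⁻¹ • α, s⁻¹ • β, s⁻¹ • γ, hyu, ?_, ?_,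
      fun j => mul_nonneg (inv_nonneg.2 hs) (hα j), hG, ?_, hsgn⟩
    · have := congrArg (fun v => s⁻¹ • v) hgx
      simpa only [Pi.smul_apply, smul_eq_mul, smul_zero, smul_add, Finset.smul_sum,
        inv_smul_smul₀ hs'.ne', smul_smul,
        ← BilevelData.gradxLagrT_smul, inv_mul_cancel₀ hs'.ne', one_smul] using this
    · have := congrArg (fun v => s⁻¹ • v) hgy
      simpa only [Pi.smul_apply, smul_eq_mul, smul_zero, smul_add, Finset.smul_sum,
        inv_smul_smul₀ hs'.ne', smul_smul,
        ← BilevelData.gradyLagrT_smul, inv_mul_cancel₀ hs'.ne', one_smul] using this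
    · simp only [Pi.smul_apply, smul_eq_mul, mul_assoc, ← Finset.mul_sum, hαG, mul_zero]
  constructor
  · intro _ hq
    -- The M-type qualification is needed only to exclude `s = 0`, where the multipliers are M-type;
    -- for `s > 0` only the C-type signs of the limit are known.
    have hs' := hs_pos MSign hmultM (hq y u hyu).1 (hq y u hyu).2
    exact final CSign hs' (hC.smul fun _ _ h => h.smul)
  · intro hR hq
    -- Here the multipliers for `s = 0` are weakened back to C-type, while the M-type signs of the
    -- conclusion come from the limit of the pairs.
    have hs' := hs_pos CSign (fun h0 => ⟨(hmultM h0).1.mono fun _ _ h => h.cSign, (hmultM h0).2⟩)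
      (hq y u hyu).1 (hq y u hyu).2
    exact final MSign hs' ((hM hR).smul fun _ _ h => h.smul (inv_pos.2 hs'))
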